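/- Let $M\in\mathbb N$ and let $\mathcal A\subset\{0,\dots,M-1\}$ satisfy $1<|\mathcal A|<M$. Put $\delta:=\frac{\log|\mathcal A|}{\log M}\in(0,1)$. For $N\in\mathbb N$ let $\ell^2_N$ be the space of functions $u:\mathbb Z/N\mathbb Z\simeq\{0,\dots,N-1\}\to\mathbb C$ with norm $\|u\|^2=\sum_{j=0}^{N-1}|u(j)|^2$, and let $\mathcal F_N u(j)=\frac1{\sqrt N}\sum_{\ell=0}^{N-1}e^{-2\pi i j\ell/N}u(\ell)$ be the unitary Fourier transform on $\ell^2_N$. For $\chi\in C_0^\infty((0,1);[0,1])$ denote by $\chi_N$ the operator on $\ell^2_N$ of multiplication by $j\mapsto\chi(j/N)$, $0\le j<N$. For $k\ge1$ and $N=M^k$ define the open quantum baker's map $$B_N=B_{N,\chi}=\sum_{a\in\mathcal A}\mathcal F_N^*\,\Pi_a^*\,\chi_{N/M}\,\mathcal F_{N/M}\,\chi_{N/M}\,\Pi_a:\ \ell^2_N\to\ell^2_N,$$ where $\Pi_a:\ell^2_N\to\ell^2_{N/M}$ is given by $\Pi_a u(j)=u\big(j+a\tfrac NM\big)$, $0\le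 j<\tfrac NM$. Theorem (Improved spectral gap). There exists $\beta=\beta(M,\mathcal A)>\max\big(0,\tfrac12-\delta\big)$, depending only on $M$ and $\mathcal A$, such that for every $\chi\in C_0^\infty((0,1);[0,1])$, $$\limsup_{k\to\infty,\ N=M^k}\ \max\{|\lambda|:\lambda\in\operatorname{Sp}(B_{N,\chi})\}\ \le\ M^{-\beta}.$$ -/

import Mathlib

open scoped ContDiff Matrix

noncomputable section

/-- Cutoff functions, i.e. elements of `C₀^∞((0,1);[0,1])`, extended by zero to `ℝ`: smooth functions
whose support is a compact subset of the open interval `(0,1)`, with values in `[0,1]`. -/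
structure IsCutoff (χ : ℝ → ℝ) : Prop where
  smooth : ContDiff ℝ ∞ χ
  hasCompactSupport : HasCompactSupport χ
  tsupport_subset : tsupport χ ⊆ Set.Ioo 0 1
  mem_Icc : ∀ x, χ x ∈ Set.Icc (0 : ℝ) 1

/-- The matrix of the unitary discrete Fourier transform on `ℓ²_N`, where `ℤ/Nℤ` is identified with
`{0, …, N - 1}`. -/
def fourierMatrix (N : ℕ) : Matrix (Fin N) (Fin N) ℂ :=
  Matrix.of fun j l =>
    ((1 / √(N : ℝ) : ℝ) : ℂ) *
      Complex.exp (-(2 * Real.pi * Complex.I * ((j : ℕ) : ℂ) * ((l : ℕ) : ℂ) / (N : ℂ)))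

/-- The multiplication operator by the discretization `χ_N(j) = χ(j/N)` of `χ`. -/
def cutoffMatrix (χ : ℝ → ℝ) (N : ℕ) : Matrix (Fin N) (Fin N) ℂ :=
  Matrix.diagonal fun j => ((χ (((j : ℕ) : ℝ) / (N : ℝ)) : ℝ) : ℂ)

/-- The projection `Π_a : ℓ²_N → ℓ²_{N/M}`, `(Π_a u)(j) = u(j + a N/M)` for `0 ≤ j < N/M`. -/
def blockProjMatrix (M N a : ℕ) : Matrix (Fin (N / M)) (Fin N) ℂ :=
  Matrix.of fun j l => if (l : ℕ) = (j : ℕ) + a * (N / M) then 1 else 0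

/-- The matrix `∑_{a ∈ A} F_N^* Π_a^* χ_{N/M} F_{N/M} χ_{N/M} Π_a` of the open quantum baker's map:
`F_N^*` times the block diagonal matrix whose `a`-th block (`0 ≤ a < M`) is
`χ_{N/M} F_{N/M} χ_{N/M}` if `a ∈ A` and zero otherwise. It is used for `N` divisible by `M`. -/
def openBakerMatrix (M : ℕ) (A : Finset ℕ) (χ : ℝ → ℝ) (N : ℕ) : Matrix (Fin N) (Fin N) ℂ :=
  ∑ a ∈ A,
    (fourierMatrix N)ᴴ * (blockProjMatrix M N a)ᴴ *
      (cutoffMatrix χ (N / M) * fourierMatrix (N / M) * cutoffMatrix χ (N / M)) *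
      blockProjMatrix M N a

/-- The open quantum baker's map `B_N` with `N = M ^ k`, as an operator on the Hilbert space
`ℓ²_N`. -/
def openBakerMap (M : ℕ) (A : Finset ℕ) (χ : ℝ → ℝ) (k : ℕ) :
    EuclideanSpace ℂ (Fin (M ^ k)) →L[ℂ] EuclideanSpace ℂ (Fin (M ^ k)) :=
  Matrix.toEuclideanCLM (n := Fin (M ^ k)) (𝕜 := ℂ) (openBakerMatrix M A χ (M ^ k))

end

/-! Write `N = M ^ k`, let `B` be the baker matrix and `F` the Fourier matrix. Summation by parts
shows that the entries of `B` decay rapidly away from the graph of the expanding map `x ↦ M x`, and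
the columns in blocks `a ∉ A` vanish (`IsCutoff.exists_bound_openBakerMatrix`,
`openBakerMatrix_apply_eq_zero`). Iterating `k` times, `B ^ k` is negligible on functions supported
off `S`, a neighbourhood of width about a small power of `N` of the Cantor set `C_k` of integers
with all `k` digits in `A`. Since `B` is `Fᴴ` times a symmetric matrix, `F * B * Fᴴ` is the
transpose of `B`, so the same kernel estimate localizes the range of `B ^ k` in frequency to `S`.
Inserting both localizations into `B ^ (2 * k) u = μ ^ (2 * k) u` bounds `|μ| ^ k` by the norm of
`1_S Fᴴ 1_S`, up to negligible errors (`norm_eigenvalue_pow_le`).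

What remains is an uncertainty principle. The norm of `1_C Fᴴ 1_C`, `C = C_k`, is submultiplicative
in `k`, so beating the exponent `max 0 (1/2 - δ)` only requires strict improvement at one scale on
each of two trivial bounds. The bound `1` improves because a nonzero function on `C` has a transform
that cannot vanish on `|C|` consecutive points (Vandermonde), whereas for large `k` a digit missing
from `A` leaves such a gap in `C`. The Hilbert–Schmidt bound `|C| / √N` improves because the
localized matrix does not have rank one. Passing from `C` to `S` costs a factor comparable to the
width, which the strict gain absorbs. -/

noncomputable section

open scoped Matrix.Norms.L2Operator

/-! ### Additive characters and the unitary discrete Fourier transform. -/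

/-- The additive character `x ↦ e^{2πix}` of `ℝ`. -/
def unitExp (x : ℝ) : ℂ := Complex.exp (((2 * Real.pi * x : ℝ) : ℂ) * Complex.I)

lemma unitExp_add (x y : ℝ) : unitExp (x + y) = unitExp x * unitExp y := by
  simp only [unitExp, ← Complex.exp_add]
  congr 1
  push_cast
  ring

@[simp] lemma unitExp_zero : unitExp 0 = 1 := by simp [unitExp]

@[simp] lemma norm_unitExp (x : ℝ) : ‖unitExp x‖ = 1 := Complex.norm_exp_ofReal_mul_I _

lemma unitExp_ne_zero (x : ℝ) : unitExp x ≠ 0 := Complex.exp_ne_zero _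

lemma unitExp_eq_one_iff (x : ℝ) : unitExp x = 1 ↔ ∃ n : ℤ, x = n := by
  rw [unitExp, Complex.exp_eq_one_iff]
  have hpi : (Real.pi : ℂ) ≠ 0 := by exact_mod_cast Real.pi_ne_zero
  refine exists_congr fun n => ⟨fun h => ?_, fun h => ?_⟩
  · have h2 : ((2 * Real.pi * Complex.I : ℂ)) * (x : ℂ) = (2 * Real.pi * Complex.I) * (n : ℂ) := by
      push_cast at h
      linear_combination h
    have := mul_left_cancel₀ (by simp [hpi]) h2
    exact_mod_cast this
  · subst h
    push_cast
    ring

@[simp] lemma unitExp_intCast (n : ℤ) : unitExp n = 1 := (unitExp_eq_one_iff _).2 ⟨n, rfl⟩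

@[simp] lemma unitExp_natCast (n : ℕ) : unitExp n = 1 := (unitExp_eq_one_iff _).2 ⟨n, by simp⟩

lemma unitExp_nat_mul (n : ℕ) (x : ℝ) : unitExp (n * x) = unitExp x ^ n := by
  rw [unitExp, unitExp, ← Complex.exp_nat_mul]
  congr 1
  push_cast
  ring

lemma star_unitExp (x : ℝ) : star (unitExp x) = unitExp (-x) := by
  rw [unitExp, unitExp, Complex.star_def, ← Complex.exp_conj, map_mul,
    Complex.conj_ofReal, Complex.conj_I]
  congr 1
  push_cast
  ring

lemma unitExp_sub (x y : ℝ) : unitExp (x - y) = unitExp x * unitExp (-y) := by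
  rw [sub_eq_add_neg, unitExp_add]

/-- If `0 < c ≤ 1 / 2` and `|x| ≤ 1 - c`, then `e^{2πix}` is quantitatively away from `1`. -/
lemma le_norm_one_sub_unitExp {c x : ℝ} (hc : 0 < c) (hc2 : c ≤ 1 / 2) (hx : |x| ≤ 1 - c) :
    4 * c * |x| ≤ ‖1 - unitExp x‖ := by
  have h1 : ‖1 - unitExp x‖ = 2 * |Real.sin (Real.pi * x)| := by
    rw [norm_sub_rev, unitExp, mul_comm, Complex.norm_exp_I_mul_ofReal_sub_one, norm_mul,
      Real.norm_eq_abs, Real.norm_eq_abs, abs_two]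
    congr 3
    ring
  have hpi := Real.pi_pos
  have h2 : |Real.sin (Real.pi * x)| = Real.sin (Real.pi * |x|) := by
    have : Real.pi * |x| = |Real.pi * x| := by rw [abs_mul, abs_of_pos hpi]
    rw [this, Real.abs_sin_eq_sin_abs_of_abs_le_pi]
    rw [← this]
    nlinarith
  rw [h1, h2]
  -- Jordan's inequality on `[0, π/2]`, after the reflection `θ ↦ π - θ` when `|x| ≥ 1/2`; there `1
  -- - |x| ≥ c ≥ c * |x|`.
  rcases le_total |x| (1 / 2) with h | h
  · have h3 := Real.mul_le_sin (x := Real.pi * |x|) (by positivity) (by nlinarith)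
    have h4 : 2 / Real.pi * (Real.pi * |x|) = 2 * |x| := by field_simp
    nlinarith [abs_nonneg x]
  · have h3 := Real.mul_le_sin (x := Real.pi - Real.pi * |x|) (by nlinarith) (by nlinarith)
    rw [Real.sin_pi_sub] at h3
    have h4 : 2 / Real.pi * (Real.pi - Real.pi * |x|) = 2 * (1 - |x|) := by field_simp
    nlinarith [abs_nonneg x]

/-- Orthogonality of the additive characters of `ℤ/Nℤ`. -/
lemma sum_unitExp_eq_zero {N : ℕ} (hN : N ≠ 0) {d : ℤ} (hd : ¬ (N : ℤ) ∣ d) :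
    ∑ l : Fin N, unitExp ((l : ℕ) * (d / N)) = 0 := by
  have hN' : (N : ℝ) ≠ 0 := by exact_mod_cast hN
  have h1 : unitExp (d / N) ≠ 1 := by
    rw [Ne, unitExp_eq_one_iff]
    rintro ⟨n, hn⟩
    rw [div_eq_iff hN'] at hn
    exact hd ⟨n, by rw [mul_comm]; exact_mod_cast hn⟩
  rw [Fin.sum_univ_eq_sum_range (fun l => unitExp (l * (d / N)))]
  simp only [unitExp_nat_mul]
  rw [geom_sum_eq h1, ← unitExp_nat_mul, mul_div_cancel₀ _ hN']
  simp

lemma fourierMatrix_apply (N : ℕ) (j l : Fin N) :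
    fourierMatrix N j l = ((1 / √(N : ℝ) : ℝ) : ℂ) * unitExp (-((j : ℕ) * (l : ℕ) / N)) := by
  simp only [fourierMatrix, Matrix.of_apply, unitExp]
  congr 2
  push_cast
  ring

lemma fourierMatrix_conjTranspose_apply (N : ℕ) (j l : Fin N) :
    (fourierMatrix N)ᴴ j l = ((1 / √(N : ℝ) : ℝ) : ℂ) * unitExp ((j : ℕ) * (l : ℕ) / N) := by
  rw [Matrix.conjTranspose_apply, fourierMatrix_apply, star_mul', star_unitExp, neg_neg]
  simp [mul_comm]

lemma fourierMatrix_transpose (N : ℕ) : (fourierMatrix N)ᵀ = fourierMatrix N := by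
  ext j l
  rw [Matrix.transpose_apply, fourierMatrix_apply, fourierMatrix_apply, mul_comm ((l : ℕ) : ℝ)]

lemma sum_unitExp_sub {N : ℕ} (j j' : Fin N) :
    ∑ l : Fin N, unitExp ((l : ℕ) * ((((j : ℕ) : ℤ) - ((j' : ℕ) : ℤ) : ℤ) / N)) =
      if j = j' then (N : ℂ) else 0 := by
  split_ifs with h
  · simp [h]
  · refine sum_unitExp_eq_zero (Nat.ne_of_gt j.pos) fun hd => h ?_
    have h1 := j.2
    have h2 := j'.2
    have := Int.eq_zero_of_abs_lt_dvd hd (by rw [abs_lt]; omega)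
    ext
    omega

lemma fourierMatrix_conjTranspose_mul (N : ℕ) : (fourierMatrix N)ᴴ * fourierMatrix N = 1 := by
  ext j l
  have hN : (N : ℝ) ≠ 0 := by exact_mod_cast Nat.ne_of_gt j.pos
  have h1 : ∀ x : Fin N, (fourierMatrix N)ᴴ j x * fourierMatrix N x l =
      ((1 / N : ℝ) : ℂ) * unitExp ((x : ℕ) * ((((j : ℕ) : ℤ) - ((l : ℕ) : ℤ) : ℤ) / N)) := by
    intro x
    rw [fourierMatrix_conjTranspose_apply, fourierMatrix_apply, mul_mul_mul_comm, ← unitExp_add,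
      ← Complex.ofReal_mul, div_mul_div_comm, one_mul, Real.mul_self_sqrt (Nat.cast_nonneg _)]
    congr 2
    push_cast
    ring
  rw [Matrix.mul_apply]
  simp only [h1]
  rw [← Finset.mul_sum, sum_unitExp_sub, Matrix.one_apply]
  split_ifs
  · have : (N : ℂ) ≠ 0 := by exact_mod_cast hN
    push_cast
    field_simp
  · simp

lemma fourierMatrix_mul_conjTranspose (N : ℕ) : fourierMatrix N * (fourierMatrix N)ᴴ = 1 :=
  mul_eq_one_comm.1 (fourierMatrix_conjTranspose_mul N)

/-! ### Operator norms on `ℓ²`. -/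

section OperatorNorm

variable {m n : Type*} [Fintype m] [Fintype n] [DecidableEq n]

lemma sum_norm_sq_mulVec_le (G : Matrix m n ℂ) (v : n → ℂ) :
    ∑ i, ‖(G *ᵥ v) i‖ ^ 2 ≤ ‖G‖ ^ 2 * ∑ j, ‖v j‖ ^ 2 := by
  have h := G.l2_opNorm_mulVec (WithLp.toLp 2 v)
  have h2 := pow_le_pow_left₀ (norm_nonneg _) h 2
  rw [mul_pow, EuclideanSpace.norm_sq_eq, EuclideanSpace.norm_sq_eq] at h2
  exact h2

lemma l2_opNorm_le_of_sum_norm_sq_le (G : Matrix m n ℂ) {C : ℝ} (hC : 0 ≤ C)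
    (h : ∀ v : n → ℂ, ∑ i, ‖(G *ᵥ v) i‖ ^ 2 ≤ C ^ 2 * ∑ j, ‖v j‖ ^ 2) : ‖G‖ ≤ C := by
  rw [Matrix.l2_opNorm_def]
  refine ContinuousLinearMap.opNorm_le_bound _ hC fun v => ?_
  refine (sq_le_sq₀ (norm_nonneg _) (by positivity)).1 ?_
  rw [mul_pow, EuclideanSpace.norm_sq_eq, EuclideanSpace.norm_sq_eq]
  exact h v

lemma l2_opNorm_le_one_of_conjTranspose_mul_self (G : Matrix n n ℂ) (h : Gᴴ * G = 1) :
    ‖G‖ ≤ 1 := by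
  refine l2_opNorm_le_of_sum_norm_sq_le G zero_le_one fun v => ?_
  have key : ∀ {k : Type _} [Fintype k] (w : k → ℂ), ((∑ i, ‖w i‖ ^ 2 : ℝ) : ℂ) = star w ⬝ᵥ w := by
    intro k _ w
    simp [dotProduct, Complex.conj_mul']
  have : ((∑ i, ‖(G *ᵥ v) i‖ ^ 2 : ℝ) : ℂ) = ((∑ j, ‖v j‖ ^ 2 : ℝ) : ℂ) := by
    rw [key, key, Matrix.star_mulVec, Matrix.dotProduct_mulVec, Matrix.vecMul_vecMul, h,
      Matrix.vecMul_one]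
  rw [one_pow, one_mul]
  exact (Complex.ofReal_injective this).le

/-- Cauchy–Schwarz in each row. The loss of the full dimension is harmless: it is applied to entries
smaller than any prescribed power of the dimension. -/
lemma l2_opNorm_le_of_entry_le (G : Matrix n n ℂ) {η : ℝ} (hη : 0 ≤ η)
    (h : ∀ i j, ‖G i j‖ ≤ η) : ‖G‖ ≤ Fintype.card n * η := by
  refine l2_opNorm_le_of_sum_norm_sq_le G (by positivity) fun v => ?_
  have h1 : ∀ i, ‖(G *ᵥ v) i‖ ^ 2 ≤ η ^ 2 * (Fintype.card n * ∑ j, ‖v j‖ ^ 2) := by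
    intro i
    have h2 : ‖(G *ᵥ v) i‖ ≤ η * ∑ j, ‖v j‖ := by
      rw [Matrix.mulVec, dotProduct, Finset.mul_sum]
      refine (norm_sum_le _ _).trans (Finset.sum_le_sum fun j _ => ?_)
      rw [norm_mul]
      gcongr
      exact h i j
    refine (pow_le_pow_left₀ (norm_nonneg _) h2 2).trans ?_
    rw [mul_pow]
    gcongr
    exact sq_sum_le_card_mul_sum_sq
  refine (Finset.sum_le_sum fun i _ => h1 i).trans (le_of_eq ?_)
  rw [Finset.sum_const, nsmul_eq_mul, Finset.card_univ]
  ring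

end OperatorNorm

/-! ### Block structure, symmetry and contractivity of the baker's map. -/

lemma norm_fourierMatrix_le_one (N : ℕ) : ‖fourierMatrix N‖ ≤ 1 :=
  l2_opNorm_le_one_of_conjTranspose_mul_self _ (fourierMatrix_conjTranspose_mul N)

lemma norm_fourierMatrix_conjTranspose_le_one (N : ℕ) : ‖(fourierMatrix N)ᴴ‖ ≤ 1 := by
  rw [Matrix.l2_opNorm_conjTranspose]
  exact norm_fourierMatrix_le_one N

lemma norm_cutoffMatrix_le_one {χ : ℝ → ℝ} (hχ : IsCutoff χ) (N : ℕ) :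
    ‖cutoffMatrix χ N‖ ≤ 1 := by
  rw [cutoffMatrix, Matrix.l2_opNorm_diagonal, pi_norm_le_iff_of_nonneg zero_le_one]
  intro i
  have := hχ.mem_Icc ((i : ℕ) / (N : ℝ))
  rw [Complex.norm_real, Real.norm_eq_abs, abs_le]
  exact ⟨by linarith [this.1], this.2⟩

/-- The localized Fourier transform `χ_N F_N χ_N`. -/
def localFourier (χ : ℝ → ℝ) (N : ℕ) : Matrix (Fin N) (Fin N) ℂ :=
  cutoffMatrix χ N * fourierMatrix N * cutoffMatrix χ N

lemma norm_localFourier_le_one {χ : ℝ → ℝ} (hχ : IsCutoff χ) (N : ℕ) :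
    ‖localFourier χ N‖ ≤ 1 := by
  have h1 := norm_cutoffMatrix_le_one hχ N
  have h2 := norm_fourierMatrix_le_one N
  refine (norm_mul_le _ _).trans (mul_le_one₀ ((norm_mul_le _ _).trans ?_) (norm_nonneg _) h1)
  exact mul_le_one₀ h1 (norm_nonneg _) h2

lemma localFourier_transpose (χ : ℝ → ℝ) (N : ℕ) :
    (localFourier χ N)ᵀ = localFourier χ N := by
  simp [localFourier, Matrix.transpose_mul, fourierMatrix_transpose, cutoffMatrix, Matrix.mul_assoc]

/-- The block diagonal part of the open baker's map. -/
def bakerBlock (M : ℕ) (A : Finset ℕ) (χ : ℝ → ℝ) (N : ℕ) : Matrix (Fin N) (Fin N) ℂ :=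
  ∑ a ∈ A, (blockProjMatrix M N a)ᴴ * localFourier χ (N / M) * blockProjMatrix M N a

lemma openBakerMatrix_eq (M : ℕ) (A : Finset ℕ) (χ : ℝ → ℝ) (N : ℕ) :
    openBakerMatrix M A χ N = (fourierMatrix N)ᴴ * bakerBlock M A χ N := by
  simp only [openBakerMatrix, bakerBlock, localFourier, Finset.mul_sum, Matrix.mul_assoc]

lemma blockProjMatrix_conjTranspose (M N a : ℕ) :
    (blockProjMatrix M N a)ᴴ = (blockProjMatrix M N a)ᵀ := by
  ext i j
  simp only [Matrix.conjTranspose_apply, Matrix.transpose_apply, blockProjMatrix, Matrix.of_apply]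
  split_ifs <;> simp

/-- The Fourier kernel depends only on the product `j * l`, and the cutoffs and block projections
are real. This symmetry lets one kernel estimate serve both position and frequency. -/
lemma bakerBlock_transpose (M : ℕ) (A : Finset ℕ) (χ : ℝ → ℝ) (N : ℕ) :
    (bakerBlock M A χ N)ᵀ = bakerBlock M A χ N := by
  simp [bakerBlock, Matrix.transpose_sum, Matrix.transpose_mul, blockProjMatrix_conjTranspose,
    localFourier_transpose, Matrix.mul_assoc]

/-- Conjugating the baker's map by the Fourier transform gives its transpose. -/
lemma openBakerMatrix_transpose (M : ℕ) (A : Finset ℕ) (χ : ℝ → ℝ) (N : ℕ) :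
    (openBakerMatrix M A χ N)ᵀ =
      fourierMatrix N * openBakerMatrix M A χ N * (fourierMatrix N)ᴴ := by
  have h : ((fourierMatrix N)ᴴ)ᵀ = (fourierMatrix N)ᴴ := by
    ext j l
    rw [Matrix.transpose_apply, fourierMatrix_conjTranspose_apply,
      fourierMatrix_conjTranspose_apply, mul_comm ((l : ℕ) : ℝ)]
  rw [openBakerMatrix_eq, Matrix.transpose_mul, bakerBlock_transpose, h, ← Matrix.mul_assoc,
    fourierMatrix_mul_conjTranspose, Matrix.one_mul]

/-- The splitting of `{0, …, N - 1}` into `M` blocks of length `N / M`. -/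
def blockEquiv {M N : ℕ} (h : M * (N / M) = N) : Fin M × Fin (N / M) ≃ Fin N :=
  finProdFinEquiv.trans (finCongr h)

lemma blockEquiv_val {M N : ℕ} (h : M * (N / M) = N) (b : Fin M) (j : Fin (N / M)) :
    (blockEquiv h (b, j) : ℕ) = j + b * (N / M) := by
  simp [blockEquiv, mul_comm]

lemma blockProjMatrix_blockEquiv {M N : ℕ} (h : M * (N / M) = N) (a : ℕ) (b : Fin M)
    (i j : Fin (N / M)) :
    blockProjMatrix M N a i (blockEquiv h (b, j)) = if a = b ∧ i = j then 1 else 0 := by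
  rw [blockProjMatrix, Matrix.of_apply, blockEquiv_val]
  refine if_congr ⟨fun h1 => ?_, ?_⟩ rfl rfl
  · have hpos : 0 < N / M := i.pos
    have h2 := congrArg (· / (N / M)) h1
    have h3 := congrArg (· % (N / M)) h1
    simp only [Nat.add_mul_mod_self_right, Nat.mod_eq_of_lt i.2, Nat.mod_eq_of_lt j.2] at h3
    simp only [Nat.add_mul_div_right _ _ hpos, Nat.div_eq_of_lt i.2, Nat.div_eq_of_lt j.2] at h2
    exact ⟨by omega, Fin.ext h3.symm⟩
  · rintro ⟨rfl, rfl⟩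
    rfl

lemma blockProjMatrix_mulVec {M N : ℕ} (h : M * (N / M) = N) (b : Fin M) (v : Fin N → ℂ)
    (i : Fin (N / M)) : (blockProjMatrix M N b *ᵥ v) i = v (blockEquiv h (b, i)) := by
  rw [Matrix.mulVec, dotProduct, ← (blockEquiv h).sum_comp, Fintype.sum_prod_type,
    Finset.sum_eq_single b]
  · simp [blockProjMatrix_blockEquiv]
  · intro c _ hc
    refine Finset.sum_eq_zero fun j _ => ?_
    rw [blockProjMatrix_blockEquiv, if_neg, zero_mul]
    exact fun h1 => hc (Fin.ext h1.1.symm)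
  · simp

lemma blockProjMatrix_conjTranspose_mulVec {M N : ℕ} (h : M * (N / M) = N) (a : ℕ) (b : Fin M)
    (w : Fin (N / M) → ℂ) (j : Fin (N / M)) :
    ((blockProjMatrix M N a)ᴴ *ᵥ w) (blockEquiv h (b, j)) = if a = b then w j else 0 := by
  rw [Matrix.mulVec, dotProduct, Finset.sum_eq_single j]
  · simp [blockProjMatrix_blockEquiv]
  · intro i _ hi
    simp [blockProjMatrix_blockEquiv, hi]
  · simp

lemma bakerBlock_mulVec {M N : ℕ} (h : M * (N / M) = N) (A : Finset ℕ) (χ : ℝ → ℝ)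
    (v : Fin N → ℂ) (b : Fin M) (j : Fin (N / M)) :
    (bakerBlock M A χ N *ᵥ v) (blockEquiv h (b, j)) =
      if (b : ℕ) ∈ A then (localFourier χ (N / M) *ᵥ (blockProjMatrix M N b *ᵥ v)) j else 0 := by
  rw [bakerBlock, Matrix.sum_mulVec, Finset.sum_apply]
  simp only [Matrix.mul_assoc, ← Matrix.mulVec_mulVec]
  simp only [blockProjMatrix_conjTranspose_mulVec]
  exact Finset.sum_ite_eq' A (b : ℕ) _

lemma norm_bakerBlock_le_one {M N : ℕ} (h : M * (N / M) = N) (A : Finset ℕ) {χ : ℝ → ℝ}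
    (hχ : IsCutoff χ) : ‖bakerBlock M A χ N‖ ≤ 1 := by
  refine l2_opNorm_le_of_sum_norm_sq_le _ zero_le_one fun v => ?_
  rw [one_pow, one_mul, ← (blockEquiv h).sum_comp, ← (blockEquiv h).sum_comp,
    Fintype.sum_prod_type, Fintype.sum_prod_type]
  refine Finset.sum_le_sum fun b _ => ?_
  simp only [bakerBlock_mulVec]
  split_ifs
  · refine (sum_norm_sq_mulVec_le _ _).trans ?_
    simp only [← blockProjMatrix_mulVec h]
    refine mul_le_of_le_one_left (Finset.sum_nonneg fun _ _ => by positivity) ?_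
    exact pow_le_one₀ (norm_nonneg _) (norm_localFourier_le_one hχ _)
  · simp only [norm_zero, ne_eq, OfNat.ofNat_ne_zero, not_false_eq_true, zero_pow,
      Finset.sum_const_zero]
    exact Finset.sum_nonneg fun _ _ => by positivity

lemma norm_openBakerMatrix_le_one {M N : ℕ} (h : M * (N / M) = N) (A : Finset ℕ) {χ : ℝ → ℝ}
    (hχ : IsCutoff χ) : ‖openBakerMatrix M A χ N‖ ≤ 1 := by
  rw [openBakerMatrix_eq]
  exact (norm_mul_le _ _).trans (mul_le_one₀ (norm_fourierMatrix_conjTranspose_le_one N)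
    (norm_nonneg _) (norm_bakerBlock_le_one h A hχ))

lemma norm_openBakerMatrix_transpose_le_one {M N : ℕ} (h : M * (N / M) = N) (A : Finset ℕ)
    {χ : ℝ → ℝ} (hχ : IsCutoff χ) : ‖(openBakerMatrix M A χ N)ᵀ‖ ≤ 1 := by
  rw [openBakerMatrix_transpose]
  refine (norm_mul_le _ _).trans (mul_le_one₀ ((norm_mul_le _ _).trans ?_) (norm_nonneg _)
    (norm_fourierMatrix_conjTranspose_le_one N))
  exact mul_le_one₀ (norm_fourierMatrix_le_one N) (norm_nonneg _)
    (norm_openBakerMatrix_le_one h A hχ)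

/-! ### Summation by parts and rapid decay of exponential sums. -/

/-- The backward difference `x ↦ g x - g (x - h)`. -/
def backDiff (h : ℝ) (g : ℝ → ℝ) (x : ℝ) : ℝ := g x - g (x - h)

lemma contDiff_backDiff {g : ℝ → ℝ} (hg : ContDiff ℝ ∞ g) (h : ℝ) : ContDiff ℝ ∞ (backDiff h g) :=
  hg.sub (hg.comp (contDiff_id.sub contDiff_const))

lemma contDiff_iterate_backDiff (h : ℝ) (L : ℕ) :
    ∀ {g : ℝ → ℝ}, ContDiff ℝ ∞ g → ContDiff ℝ ∞ ((backDiff h)^[L] g) := by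
  induction L with
  | zero => exact fun hg => hg
  | succ L ih => exact fun hg => ih (contDiff_backDiff hg h)

lemma deriv_backDiff {g : ℝ → ℝ} (hg : ContDiff ℝ ∞ g) (h : ℝ) :
    deriv (backDiff h g) = backDiff h (deriv g) := by
  have hd : Differentiable ℝ g := hg.differentiable (by simp)
  ext x
  have h1 : deriv (fun x => g x - g (x - h)) x = deriv g x - deriv (fun x => g (x - h)) x :=
    deriv_fun_sub (hd x) ((hd (x - h)).comp x (by fun_prop))
  rw [deriv_comp_sub_const] at h1
  exact h1

lemma deriv_iterate_backDiff (h : ℝ) (L : ℕ) :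
    ∀ {g : ℝ → ℝ}, ContDiff ℝ ∞ g →
      deriv ((backDiff h)^[L] g) = (backDiff h)^[L] (deriv g) := by
  induction L with
  | zero => exact fun _ => rfl
  | succ L ih =>
    intro g hg
    rw [Function.iterate_succ_apply, Function.iterate_succ_apply, ih (contDiff_backDiff hg h),
      deriv_backDiff hg]

/-- Differencing commutes with differentiation, so each difference costs one derivative and gains
one factor `|h|` by the mean value inequality; `C` bounds the `L`-th derivative and is uniform in
`h`. -/
lemma exists_bound_iterate_backDiff (L : ℕ) :
    ∀ g : ℝ → ℝ, ContDiff ℝ ∞ g → HasCompactSupport g →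
      ∃ C : ℝ, 0 ≤ C ∧ ∀ h x : ℝ, |(backDiff h)^[L] g x| ≤ C * |h| ^ L := by
  induction L with
  | zero =>
    intro g hg hc
    obtain ⟨C, hC⟩ := hc.exists_bound_of_continuous hg.continuous
    refine ⟨C, (norm_nonneg _).trans (hC 0), fun h x => ?_⟩
    simpa using hC x
  | succ L ih =>
    intro g hg hc
    obtain ⟨C, hC0, hC⟩ := ih (deriv g) (contDiff_infty_iff_deriv.1 hg).2 hc.deriv
    refine ⟨C, hC0, fun h x => ?_⟩
    rw [Function.iterate_succ_apply']
    have hd : Differentiable ℝ ((backDiff h)^[L] g) :=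
      (contDiff_iterate_backDiff h L hg).differentiable (by simp)
    have h1 := Convex.norm_image_sub_le_of_norm_deriv_le (s := Set.univ) (𝕜 := ℝ)
      (f := (backDiff h)^[L] g) (C := C * |h| ^ L) (x := x - h) (y := x)
      (fun y _ => hd y) (fun y _ => by rw [deriv_iterate_backDiff h L hg]; exact hC h y)
      convex_univ (Set.mem_univ _) (Set.mem_univ _)
    rw [sub_sub_cancel, Real.norm_eq_abs, Real.norm_eq_abs] at h1
    rw [pow_succ, ← mul_assoc]
    exact h1

lemma one_sub_mul_sum_range (g : ℝ → ℝ) (h : ℝ) (z : ℂ) (Q : ℕ) :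
    (1 - z) * ∑ m ∈ Finset.range Q, (g (m * h) : ℂ) * z ^ m =
      ∑ m ∈ Finset.range Q, (backDiff h g (m * h) : ℂ) * z ^ m + g (-h) -
        g (Q * h - h) * z ^ Q := by
  induction Q with
  | zero => simp
  | succ Q ih =>
    rw [Finset.sum_range_succ, Finset.sum_range_succ, mul_add, ih]
    have h1 : ((Q + 1 : ℕ) : ℝ) * h - h = Q * h := by push_cast; ring
    rw [h1, backDiff]
    push_cast
    ring

/-- Abel summation repeated `L` times. Each difference extends the support to the right by `h`, and
the margin `P + L ≤ Q` keeps every boundary term zero. -/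
lemma one_sub_pow_mul_sum_range {h : ℝ} (hh : 0 ≤ h) (z : ℂ) (L : ℕ) :
    ∀ (g : ℝ → ℝ) (P Q : ℕ), (∀ x ≤ 0, g x = 0) → (∀ x, P * h ≤ x → g x = 0) → P + L ≤ Q →
    (1 - z) ^ L * ∑ m ∈ Finset.range Q, (g (m * h) : ℂ) * z ^ m =
      ∑ m ∈ Finset.range Q, ((backDiff h)^[L] g (m * h) : ℂ) * z ^ m := by
  induction L with
  | zero => simp
  | succ L ih =>
    intro g P Q h0 h1 hPQ
    have e1 : g (-h) = 0 := h0 _ (by linarith)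
    have e2 : g (Q * h - h) = 0 := by
      refine h1 _ ?_
      have : ((P + 1 : ℕ) : ℝ) * h ≤ Q * h := by gcongr; omega
      push_cast at this
      linarith
    rw [pow_succ, mul_assoc, one_sub_mul_sum_range, e1, e2, Complex.ofReal_zero, zero_mul,
      add_zero, sub_zero, Function.iterate_succ_apply]
    refine ih (backDiff h g) (P + 1) Q (fun x hx => ?_) (fun x hx => ?_) (by omega)
    · rw [backDiff, h0 x hx, h0 (x - h) (by linarith), sub_zero]
    · push_cast at hx
      rw [backDiff, h1 x (by linarith), h1 (x - h) (by linarith), sub_zero]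

lemma IsCutoff.eq_zero_of_nonpos {χ : ℝ → ℝ} (hχ : IsCutoff χ) {x : ℝ} (hx : x ≤ 0) : χ x = 0 :=
  image_eq_zero_of_notMem_tsupport fun h => absurd (hχ.tsupport_subset h).1 (by linarith)

lemma IsCutoff.eq_zero_of_one_le {χ : ℝ → ℝ} (hχ : IsCutoff χ) {x : ℝ} (hx : 1 ≤ x) : χ x = 0 :=
  image_eq_zero_of_notMem_tsupport fun h => absurd (hχ.tsupport_subset h).2 (by linarith)

/-- By compactness `min x (1 - x)` attains a positive minimum on the support. -/
lemma IsCutoff.exists_support_subset {χ : ℝ → ℝ} (hχ : IsCutoff χ) :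
    ∃ c : ℝ, 0 < c ∧ c ≤ 1 / 2 ∧ ∀ x, χ x ≠ 0 → c ≤ x ∧ x ≤ 1 - c := by
  rcases (tsupport χ).eq_empty_or_nonempty with he | hne
  · refine ⟨1 / 2, by norm_num, le_rfl, fun x hx => ?_⟩
    have := subset_tsupport χ hx
    simp [he] at this
  · obtain ⟨y, hy, hmin⟩ := hχ.hasCompactSupport.isCompact.exists_isMinOn hne
      (f := fun x : ℝ => min x (1 - x)) (by fun_prop)
    have hy' := hχ.tsupport_subset hy
    refine ⟨min y (1 - y), lt_min hy'.1 (by linarith [hy'.2]), ?_, fun x hx => ?_⟩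
    · rcases le_total y (1 / 2) with h | h
      · exact (min_le_left _ _).trans h
      · exact (min_le_right _ _).trans (by linarith)
    · have h1 : min y (1 - y) ≤ min x (1 - x) := hmin (subset_tsupport χ hx)
      have h2 := h1.trans (min_le_left _ _)
      have h3 := h1.trans (min_le_right _ _)
      exact ⟨h2, by linarith⟩

/-- Rapid decay of the exponential sums of a discretized cutoff function. -/
lemma IsCutoff.exists_bound_sum {χ : ℝ → ℝ} (hχ : IsCutoff χ) (L : ℕ) :
    ∃ C : ℝ, 0 ≤ C ∧ ∀ (n : ℕ) (x : ℝ), 0 < n →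
      (n * ‖1 - unitExp x‖) ^ L * ‖∑ m : Fin n, (χ ((m : ℕ) / n) : ℂ) * unitExp ((m : ℕ) * x)‖ ≤
        C * n := by
  obtain ⟨C, hC0, hC⟩ := exists_bound_iterate_backDiff L χ hχ.smooth hχ.hasCompactSupport
  refine ⟨C * (L + 1), by positivity, fun n x hn => ?_⟩
  have hn' : (0 : ℝ) < n := by exact_mod_cast hn
  -- The sum is padded by `L` zero terms to leave room for `L` summations by parts.
  have h1 : ∑ m : Fin n, (χ ((m : ℕ) / n) : ℂ) * unitExp ((m : ℕ) * x) =
      ∑ m ∈ Finset.range (n + L), (χ (m * (1 / n : ℝ)) : ℂ) * unitExp x ^ m := by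
    rw [Fin.sum_univ_eq_sum_range (fun m => (χ ((m : ℝ) / n) : ℂ) * unitExp (m * x)),
      Finset.range_eq_Ico, ← Finset.sum_subset (s₁ := Finset.Ico 0 n) (s₂ := Finset.range (n + L))]
    · refine Finset.sum_congr rfl fun m _ => ?_
      rw [unitExp_nat_mul, mul_one_div]
    · intro m hm
      simp only [Finset.mem_Ico, Finset.mem_range] at *
      omega
    · intro m _ hm
      have hm' : (n : ℝ) ≤ m := by
        simp only [Finset.mem_Ico, not_and, not_lt] at hm
        exact_mod_cast hm (Nat.zero_le _)
      rw [hχ.eq_zero_of_one_le, Complex.ofReal_zero, zero_mul]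
      rw [mul_one_div]
      exact (one_le_div hn').2 hm'
  have h2 := one_sub_pow_mul_sum_range (h := 1 / n) (by positivity) (unitExp x) L χ n (n + L)
    (fun y hy => hχ.eq_zero_of_nonpos hy)
    (fun y hy => hχ.eq_zero_of_one_le (by rwa [mul_one_div_cancel hn'.ne'] at hy)) le_rfl
  have h3 : ‖∑ m ∈ Finset.range (n + L), ((backDiff (1 / n))^[L] χ (m * (1 / n : ℝ)) : ℂ) *
      unitExp x ^ m‖ ≤ (n + L) * (C * (1 / n) ^ L) := by
    refine (norm_sum_le _ _).trans ((Finset.sum_le_card_nsmul _ _ (C * (1 / n) ^ L) ?_).trans ?_)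
    · intro m _
      rw [norm_mul, norm_pow, norm_unitExp, one_pow, mul_one, Complex.norm_real, Real.norm_eq_abs]
      have := hC (1 / n) (m * (1 / n))
      rwa [abs_of_pos (by positivity : (0 : ℝ) < 1 / n)] at this
    · rw [Finset.card_range, nsmul_eq_mul]
      push_cast
      exact le_rfl
  rw [h1, mul_pow, mul_assoc, ← norm_pow, ← norm_mul, h2]
  calc (n : ℝ) ^ L * _ ≤ n ^ L * ((n + L) * (C * (1 / n) ^ L)) := by gcongr
    _ = C * (n + L) := by
      rw [one_div, inv_pow]
      field_simp
    _ ≤ C * (n + L * n) := by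
      have : (1 : ℝ) ≤ n := by exact_mod_cast hn
      gcongr
      exact le_mul_of_one_le_right (Nat.cast_nonneg _) this
    _ = C * (L + 1) * n := by ring

/-! ### Concentration of the kernel near the graph of the expanding map. -/

lemma bakerBlock_apply {M N : ℕ} (h : M * (N / M) = N) (A : Finset ℕ) (χ : ℝ → ℝ)
    (b c : Fin M) (i j : Fin (N / M)) :
    bakerBlock M A χ N (blockEquiv h (b, i)) (blockEquiv h (c, j)) =
      if (b : ℕ) ∈ A ∧ b = c then localFourier χ (N / M) i j else 0 := by
  have h1 := bakerBlock_mulVec h A χ (Pi.single (blockEquiv h (c, j)) 1) b i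
  rw [Matrix.mulVec_single_one] at h1
  have h2 : blockProjMatrix M N b *ᵥ Pi.single (blockEquiv h (c, j)) (1 : ℂ) =
      if b = c then Pi.single j 1 else 0 := by
    ext i
    rw [Matrix.mulVec_single_one, Matrix.col_apply, blockProjMatrix_blockEquiv]
    by_cases hbc : b = c
    · by_cases hij : i = j
      · simp [hbc, hij]
      · simp [hbc, hij]
    · simp [hbc, Fin.val_inj]
  rw [h2] at h1
  rw [Matrix.col_apply] at h1
  rw [h1]
  by_cases hb : (b : ℕ) ∈ A <;> by_cases hbc : b = c <;>
    simp [hb, hbc]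

lemma openBakerMatrix_apply {M N : ℕ} (h : M * (N / M) = N) (A : Finset ℕ) (χ : ℝ → ℝ)
    (c : Fin M) (i : Fin N) (j : Fin (N / M)) :
    openBakerMatrix M A χ N i (blockEquiv h (c, j)) =
      if (c : ℕ) ∈ A then
        ∑ m, (fourierMatrix N)ᴴ i (blockEquiv h (c, m)) * localFourier χ (N / M) m j else 0 := by
  rw [openBakerMatrix_eq, Matrix.mul_apply, ← (blockEquiv h).sum_comp, Fintype.sum_prod_type,
    Finset.sum_eq_single c]
  · simp only [bakerBlock_apply, and_true]
    split_ifs <;> simp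
  · intro b _ hb
    simp [bakerBlock_apply, hb]
  · simp

/-- All cancellation sits in the sum over the intermediate index `m`, where the phases of the two
Fourier transforms combine to `m * (i - M * j) / N`. The factor `χ` at `j` is retained because it
later keeps this frequency away from `±1`. -/
lemma norm_openBakerMatrix_apply_le {M N : ℕ} (h : M * (N / M) = N) (A : Finset ℕ) {χ : ℝ → ℝ}
    (hχ : IsCutoff χ) (hN : 0 < N) (c : Fin M) (i : Fin N) (j : Fin (N / M)) :
    ‖openBakerMatrix M A χ N i (blockEquiv h (c, j))‖ ≤
      χ ((j : ℕ) / (N / M : ℕ)) * ‖∑ m : Fin (N / M), (χ ((m : ℕ) / (N / M : ℕ)) : ℂ) *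
        unitExp ((m : ℕ) * (((i : ℕ) - M * (j : ℕ)) / N))‖ / (N / M : ℕ) := by
  rw [openBakerMatrix_apply]
  have hχ0 : 0 ≤ χ ((j : ℕ) / (N / M : ℕ)) := (hχ.mem_Icc _).1
  split_ifs
  swap
  · rw [norm_zero]
    positivity
  have hn0 : (0 : ℝ) < (N / M : ℕ) := by exact_mod_cast j.pos
  have hM0 : (0 : ℝ) < M := by exact_mod_cast c.pos
  have hNM : (N : ℝ) = M * (N / M : ℕ) := by exact_mod_cast h.symm
  have hN0 : (0 : ℝ) < N := by exact_mod_cast hN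
  have hsum : ∑ m, (fourierMatrix N)ᴴ i (blockEquiv h (c, m)) * localFourier χ (N / M) m j =
      ((1 / √(N : ℝ) * (1 / √((N / M : ℕ) : ℝ)) * χ ((j : ℕ) / (N / M : ℕ)) : ℝ) : ℂ) *
        unitExp ((i : ℕ) * (c : ℕ) / M) *
      ∑ m : Fin (N / M), (χ ((m : ℕ) / (N / M : ℕ)) : ℂ) *
        unitExp ((m : ℕ) * (((i : ℕ) - M * (j : ℕ)) / N)) := by
    rw [Finset.mul_sum]
    refine Finset.sum_congr rfl fun m _ => ?_
    rw [fourierMatrix_conjTranspose_apply, localFourier, cutoffMatrix, Matrix.mul_diagonal,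
      Matrix.diagonal_mul, fourierMatrix_apply, blockEquiv_val]
    -- The block offset contributes only the unimodular factor `unitExp (i * c / M)`, independent of
    -- `m`.
    have e1 : unitExp ((i : ℕ) * ((m + c * (N / M) : ℕ) : ℝ) / N) *
        unitExp (-((m : ℕ) * (j : ℕ) / (N / M : ℕ))) =
        unitExp ((i : ℕ) * (c : ℕ) / M) * unitExp ((m : ℕ) * (((i : ℕ) - M * (j : ℕ)) / N)) := by
      rw [← unitExp_add, ← unitExp_add]
      congr 1
      rw [Nat.cast_add, Nat.cast_mul, hNM]
      field_simp
      ring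
    rw [Complex.ofReal_mul, Complex.ofReal_mul]
    linear_combination (((1 / √(N : ℝ) : ℝ) : ℂ) * ((1 / √((N / M : ℕ) : ℝ) : ℝ) : ℂ) *
      (χ ((j : ℕ) / (N / M : ℕ)) : ℂ) * (χ ((m : ℕ) / (N / M : ℕ)) : ℂ)) * e1
  have hle : 1 / √(N : ℝ) * (1 / √((N / M : ℕ) : ℝ)) ≤ 1 / (N / M : ℕ) := by
    rw [div_mul_div_comm, one_mul]
    refine one_div_le_one_div_of_le hn0 ?_
    calc ((N / M : ℕ) : ℝ) = √((N / M : ℕ) : ℝ) * √((N / M : ℕ) : ℝ) :=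
          (Real.mul_self_sqrt hn0.le).symm
      _ ≤ √(N : ℝ) * √((N / M : ℕ) : ℝ) := by
        gcongr
        exact_mod_cast Nat.div_le_self N M
  rw [hsum, norm_mul, norm_mul, norm_unitExp, mul_one, Complex.norm_real, Real.norm_eq_abs,
    abs_of_nonneg (by positivity)]
  calc _ ≤ 1 / (N / M : ℕ) * χ ((j : ℕ) / (N / M : ℕ)) * _ := by gcongr
    _ = _ := by ring

/-- The matrix of the open baker's map is concentrated near the graph of the expanding map
`x ↦ M x` modulo `N`. -/
lemma IsCutoff.exists_bound_openBakerMatrix {χ : ℝ → ℝ} (hχ : IsCutoff χ) (M L : ℕ) :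
    ∃ C : ℝ, 0 ≤ C ∧ ∀ (N : ℕ) (h : M * (N / M) = N) (A : Finset ℕ) (c : Fin M) (i : Fin N)
      (j : Fin (N / M)) (W : ℝ), 0 < N → 0 < W → W ≤ |((i : ℕ) : ℝ) - M * (j : ℕ)| →
      ‖openBakerMatrix M A χ N i (blockEquiv h (c, j))‖ ≤ C / W ^ L := by
  obtain ⟨C, hC0, hC⟩ := hχ.exists_bound_sum L
  obtain ⟨r, hr0, hr2, hr⟩ := hχ.exists_support_subset
  refine ⟨C * (M / (4 * r)) ^ L, by positivity, fun N h A c i j W hN hW hd => ?_⟩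
  refine (norm_openBakerMatrix_apply_le h A hχ hN c i j).trans ?_
  have hn0 : (0 : ℝ) < (N / M : ℕ) := by exact_mod_cast j.pos
  have hM0 : (0 : ℝ) < M := by exact_mod_cast c.pos
  have hNM : (N : ℝ) = M * (N / M : ℕ) := by exact_mod_cast h.symm
  have hN0 : (0 : ℝ) < N := by exact_mod_cast hN
  by_cases hz : χ ((j : ℕ) / (N / M : ℕ)) = 0
  · rw [hz, zero_mul, zero_div]
    positivity
  have hχ1 := (hχ.mem_Icc ((j : ℕ) / (N / M : ℕ))).2
  have hb := hC (N / M) (((i : ℕ) - M * (j : ℕ)) / N) j.pos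
  set x : ℝ := ((i : ℕ) - M * (j : ℕ)) / N with hx
  set S := ‖∑ m : Fin (N / M), (χ ((m : ℕ) / (N / M : ℕ)) : ℂ) * unitExp ((m : ℕ) * x)‖ with hS
  have hj : M * ((j : ℕ) : ℝ) / N = (j : ℕ) / (N / M : ℕ) := by
    rw [hNM]
    field_simp
  -- There is no wrap-around: `i / N` lies in `[0, 1)` and `j / (N / M)` in `[r, 1 - r]`, so the
  -- distance of `i` to `M * j` may be measured in `ℤ` instead of modulo `N`.
  have hx1 : |x| ≤ 1 - r := by
    obtain ⟨h1, h2⟩ := hr _ hz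
    have h3 : ((i : ℕ) : ℝ) / N < 1 := (div_lt_one hN0).2 (by exact_mod_cast i.2)
    have h4 : (0 : ℝ) ≤ ((i : ℕ) : ℝ) / N := by positivity
    rw [hx, sub_div, hj, abs_le]
    constructor <;> linarith
  have hlow : 4 * r * W / M ≤ (N / M : ℕ) * ‖1 - unitExp x‖ := by
    have h1 := le_norm_one_sub_unitExp hr0 hr2 hx1
    have h2 : W / N ≤ |x| := by
      rw [hx, abs_div, abs_of_pos hN0]
      gcongr
    calc 4 * r * W / M = (N / M : ℕ) * (4 * r * (W / N)) := by
          rw [hNM]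
          field_simp
      _ ≤ (N / M : ℕ) * ‖1 - unitExp x‖ := by
          gcongr
          exact le_trans (by gcongr) h1
  have h1 : (4 * r * W / M) ^ L * S ≤ C * (N / M : ℕ) := le_trans (by gcongr) hb
  have h2 : S ≤ C * (N / M : ℕ) / (4 * r * W / M) ^ L := by
    rw [le_div_iff₀ (by positivity), mul_comm]
    exact h1
  calc _ ≤ 1 * S / (N / M : ℕ) := by gcongr
    _ ≤ 1 * (C * (N / M : ℕ) / (4 * r * W / M) ^ L) / (N / M : ℕ) := by gcongr
    _ = C * (M / (4 * r)) ^ L / W ^ L := by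
      rw [div_pow, mul_pow, div_pow]
      field_simp

lemma openBakerMatrix_apply_eq_zero {M N : ℕ} (h : M * (N / M) = N) {A : Finset ℕ} (χ : ℝ → ℝ)
    {c : Fin M} (hc : (c : ℕ) ∉ A) (i : Fin N) (j : Fin (N / M)) :
    openBakerMatrix M A χ N i (blockEquiv h (c, j)) = 0 := by
  rw [openBakerMatrix_apply, if_neg hc]

/-! ### Discrete Cantor sets. -/

/-- The discrete Cantor set of all `x < M ^ k` whose `k` digits in base `M` belong to `A`. -/
def cantorFinset (M : ℕ) (A : Finset ℕ) (k : ℕ) : Finset ℕ :=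
  (Finset.range (M ^ k)).filter fun x => ∀ i < k, x / M ^ i % M ∈ A

lemma mem_cantorFinset {M : ℕ} {A : Finset ℕ} {k x : ℕ} :
    x ∈ cantorFinset M A k ↔ x < M ^ k ∧ ∀ i < k, x / M ^ i % M ∈ A := by
  simp [cantorFinset]

/-- The base-`M` digits of `M ^ l * a + b` are the `l` digits of `b` followed by those of `a`. -/
lemma mul_add_mem_cantorFinset {M : ℕ} (hM : 0 < M) {A : Finset ℕ} {k l a b : ℕ} (hb : b < M ^ l) :
    M ^ l * a + b ∈ cantorFinset M A (k + l) ↔ a ∈ cantorFinset M A k ∧ b ∈ cantorFinset M A l := by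
  have hlt : M ^ l * a + b < M ^ (k + l) ↔ a < M ^ k := by
    rw [pow_add, mul_comm (M ^ k)]
    constructor
    · intro h
      exact lt_of_mul_lt_mul_left ((Nat.le_add_right _ _).trans_lt h) (Nat.zero_le _)
    · intro h
      calc M ^ l * a + b < M ^ l * a + M ^ l := by omega
        _ = M ^ l * (a + 1) := by ring
        _ ≤ M ^ l * M ^ k := Nat.mul_le_mul_left _ h
  have hlow : ∀ i < l, (M ^ l * a + b) / M ^ i % M = b / M ^ i % M := by
    intro i hi
    obtain ⟨d, rfl⟩ := Nat.exists_eq_add_of_lt hi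
    have : M ^ (i + d + 1) * a + b = b + M ^ i * (M * (M ^ d * a)) := by ring
    rw [this, Nat.add_mul_div_left _ _ (by positivity), Nat.add_mul_mod_self_left]
  have hhigh : ∀ i, (M ^ l * a + b) / M ^ (l + i) = a / M ^ i := by
    intro i
    rw [pow_add, ← Nat.div_div_eq_div_mul, Nat.mul_add_div (by positivity), Nat.div_eq_of_lt hb,
      add_zero]
  rw [mem_cantorFinset, mem_cantorFinset, mem_cantorFinset, hlt]
  constructor
  · rintro ⟨h1, h2⟩
    refine ⟨⟨h1, fun i hi => ?_⟩, hb, fun i hi => ?_⟩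
    · rw [← hhigh]
      exact h2 _ (by omega)
    · rw [← hlow i hi]
      exact h2 _ (by omega)
  · rintro ⟨⟨h1, h2⟩, -, h3⟩
    refine ⟨h1, fun i hi => ?_⟩
    rcases lt_or_ge i l with h | h
    · rw [hlow i h]
      exact h3 i h
    · obtain ⟨d, rfl⟩ := Nat.exists_eq_add_of_le h
      rw [hhigh]
      exact h2 d (by omega)

lemma sum_cantorFinset_add {β : Type*} [AddCommMonoid β] {M : ℕ} (hM : 0 < M) (A : Finset ℕ)
    (k l : ℕ) (f : ℕ → β) :
    ∑ x ∈ cantorFinset M A (k + l), f x =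
      ∑ a ∈ cantorFinset M A k, ∑ b ∈ cantorFinset M A l, f (M ^ l * a + b) := by
  have hpos : 0 < M ^ l := by positivity
  rw [← Finset.sum_product']
  refine Finset.sum_nbij' (fun x => (x / M ^ l, x % M ^ l)) (fun p => M ^ l * p.1 + p.2) ?_ ?_ ?_ ?_
    ?_
  · intro x hx
    rw [Finset.mem_product, ← mul_add_mem_cantorFinset hM (Nat.mod_lt _ hpos), Nat.div_add_mod]
    exact hx
  · rintro ⟨a, b⟩ hp
    rw [Finset.mem_product] at hp
    exact (mul_add_mem_cantorFinset hM (mem_cantorFinset.1 hp.2).1).2 hp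
  · intro x _
    exact Nat.div_add_mod _ _
  · rintro ⟨a, b⟩ hp
    rw [Finset.mem_product] at hp
    have hb := (mem_cantorFinset.1 hp.2).1
    simp only at hb
    simp only [Nat.mul_add_div hpos, Nat.div_eq_of_lt hb, add_zero, Nat.mul_add_mod,
      Nat.mod_eq_of_lt hb]
  · intro x _
    simp only [Nat.div_add_mod]

lemma cantorFinset_zero (M : ℕ) (A : Finset ℕ) : cantorFinset M A 0 = {0} := by
  ext x
  simp [mem_cantorFinset]

lemma cantorFinset_one {M : ℕ} {A : Finset ℕ} (hA : A ⊆ Finset.range M) :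
    cantorFinset M A 1 = A := by
  ext x
  rw [mem_cantorFinset]
  constructor
  · rintro ⟨h1, h2⟩
    have := h2 0 one_pos
    rwa [pow_zero, Nat.div_one, Nat.mod_eq_of_lt (by simpa using h1)] at this
  · intro hx
    have hlt := Finset.mem_range.1 (hA hx)
    refine ⟨by simpa using hlt, fun i hi => ?_⟩
    obtain rfl : i = 0 := by omega
    rwa [pow_zero, Nat.div_one, Nat.mod_eq_of_lt hlt]

lemma card_cantorFinset {M : ℕ} (hM : 0 < M) {A : Finset ℕ} (hA : A ⊆ Finset.range M) (k : ℕ) :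
    (cantorFinset M A k).card = A.card ^ k := by
  induction k with
  | zero => simp [cantorFinset_zero]
  | succ k ih =>
    rw [Finset.card_eq_sum_ones, sum_cantorFinset_add hM, cantorFinset_one hA]
    simp [ih, pow_succ]

lemma cantorFinset_subset_range (M : ℕ) (A : Finset ℕ) (k : ℕ) :
    cantorFinset M A k ⊆ Finset.range (M ^ k) := Finset.filter_subset _ _

/-! ### The fractal uncertainty principle. -/

/-- `K` bounds the square of the norm of `(e^{2πixy/N})` as an operator on `ℓ²(X)`. -/
def FourierBound (X : Finset ℕ) (N : ℕ) (K : ℝ) : Prop :=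
  ∀ u : ℕ → ℂ, ∑ y ∈ X, ‖∑ x ∈ X, u x * unitExp ((x : ℝ) * y / N)‖ ^ 2 ≤ K * ∑ x ∈ X, ‖u x‖ ^ 2

lemma FourierBound.mono {X : Finset ℕ} {N : ℕ} {K K' : ℝ} (h : FourierBound X N K) (hK : K ≤ K') :
    FourierBound X N K' := fun u =>
  (h u).trans (mul_le_mul_of_nonneg_right hK (Finset.sum_nonneg fun _ _ => by positivity))

/-- Submultiplicativity of the norm of the Fourier transform localized to discrete Cantor sets. -/
lemma FourierBound.cantorFinset_add {M : ℕ} (hM : 0 < M) {A : Finset ℕ} {k l : ℕ} {K K' : ℝ}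
    (hK' : 0 ≤ K') (h : FourierBound (cantorFinset M A k) (M ^ k) K)
    (h' : FourierBound (cantorFinset M A l) (M ^ l) K') :
    FourierBound (cantorFinset M A (k + l)) (M ^ (k + l)) (K * K') := by
  intro u
  have hM0 : (M : ℝ) ≠ 0 := by exact_mod_cast hM.ne'
  -- As in the fast Fourier transform, the two variables are split at opposite places (`l` low
  -- digits in one, `k` in the other). Then `a * p` contributes an integer to the phase, leaving a
  -- transform of size `M ^ k`, a unimodular twist and a transform of size `M ^ l`.
  have hphase : ∀ a b p q : ℕ,
      unitExp (((M ^ l * a + b : ℕ) : ℝ) * ((M ^ k * p + q : ℕ) : ℝ) / ((M ^ (k + l) : ℕ) : ℝ)) =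
        unitExp ((a : ℝ) * q / ((M ^ k : ℕ) : ℝ)) * unitExp ((b : ℝ) * q / ((M ^ (k + l) : ℕ) : ℝ)) *
          unitExp ((b : ℝ) * p / ((M ^ l : ℕ) : ℝ)) := by
    intro a b p q
    rw [← unitExp_add, ← unitExp_add]
    have : ((M ^ l * a + b : ℕ) : ℝ) * ((M ^ k * p + q : ℕ) : ℝ) / ((M ^ (k + l) : ℕ) : ℝ) =
        ((a * p : ℕ) : ℝ) + ((a : ℝ) * q / ((M ^ k : ℕ) : ℝ) +
          (b : ℝ) * q / ((M ^ (k + l) : ℕ) : ℝ) + (b : ℝ) * p / ((M ^ l : ℕ) : ℝ)) := by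
      push_cast
      rw [pow_add]
      field_simp
      ring
    rw [this, unitExp_add, unitExp_natCast, one_mul]
  set U : ℕ → ℕ → ℂ := fun q b =>
    ∑ a ∈ cantorFinset M A k, u (M ^ l * a + b) * unitExp ((a : ℝ) * q / ((M ^ k : ℕ) : ℝ)) with hU
  have hsum : ∀ p q : ℕ, ∑ x ∈ cantorFinset M A (k + l),
      u x * unitExp ((x : ℝ) * ((M ^ k * p + q : ℕ) : ℝ) / ((M ^ (k + l) : ℕ) : ℝ)) =
      ∑ b ∈ cantorFinset M A l, (U q b * unitExp ((b : ℝ) * q / ((M ^ (k + l) : ℕ) : ℝ))) *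
        unitExp ((b : ℝ) * p / ((M ^ l : ℕ) : ℝ)) := by
    intro p q
    rw [sum_cantorFinset_add hM, Finset.sum_comm]
    refine Finset.sum_congr rfl fun b _ => ?_
    rw [hU, Finset.sum_mul, Finset.sum_mul]
    refine Finset.sum_congr rfl fun a _ => ?_
    rw [hphase]
    ring
  rw [show cantorFinset M A (k + l) = cantorFinset M A (l + k) by rw [add_comm],
    sum_cantorFinset_add hM A l k, show cantorFinset M A (l + k) = cantorFinset M A (k + l) by
      rw [add_comm], Finset.sum_comm]
  simp only [hsum]
  calc _ ≤ ∑ q ∈ cantorFinset M A k, K' * ∑ b ∈ cantorFinset M A l, ‖U q b‖ ^ 2 := by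
        refine Finset.sum_le_sum fun q _ => (h' _).trans (le_of_eq ?_)
        simp
    _ = K' * ∑ b ∈ cantorFinset M A l, ∑ q ∈ cantorFinset M A k, ‖U q b‖ ^ 2 := by
        rw [← Finset.mul_sum, Finset.sum_comm]
    _ ≤ K' * ∑ b ∈ cantorFinset M A l, K * ∑ a ∈ cantorFinset M A k, ‖u (M ^ l * a + b)‖ ^ 2 := by
        gcongr with b _
        exact h fun a => u (M ^ l * a + b)
    _ = K * K' * ∑ x ∈ cantorFinset M A (k + l), ‖u x‖ ^ 2 := by
        rw [← Finset.mul_sum, sum_cantorFinset_add hM, Finset.sum_comm]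
        ring

lemma FourierBound.cantorFinset_mul {M : ℕ} (hM : 0 < M) {A : Finset ℕ} {k : ℕ} {K : ℝ}
    (hK : 0 ≤ K) (h : FourierBound (cantorFinset M A k) (M ^ k) K) (t : ℕ) :
    FourierBound (cantorFinset M A (k * t)) (M ^ (k * t)) (K ^ t) := by
  induction t with
  | zero =>
    intro u
    simp [cantorFinset_zero]
  | succ t ih => exact FourierBound.cantorFinset_add hM hK ih h

/-- Bessel's inequality on `ℤ/Nℤ`. -/
lemma sum_range_norm_sq_le {X : Finset ℕ} {N : ℕ} (hX : X ⊆ Finset.range N) (u : ℕ → ℂ) :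
    ∑ y ∈ Finset.range N, ‖∑ x ∈ X, u x * unitExp ((x : ℝ) * y / N)‖ ^ 2 ≤
      N * ∑ x ∈ X, ‖u x‖ ^ 2 := by
  rcases Nat.eq_zero_or_pos N with rfl | hN
  · simp
  have hN' : (0 : ℝ) < N := by exact_mod_cast hN
  have h1 := sum_norm_sq_mulVec_le (fourierMatrix N)ᴴ
    (fun x : Fin N => if (x : ℕ) ∈ X then u x else 0)
  have h2 : ∀ y : Fin N, ((fourierMatrix N)ᴴ *ᵥ fun x : Fin N => if (x : ℕ) ∈ X then u x else 0) y =
      ((1 / √(N : ℝ) : ℝ) : ℂ) * ∑ x ∈ X, u x * unitExp ((x : ℝ) * (y : ℕ) / N) := by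
    intro y
    have h3 : ∑ x ∈ X, u x * unitExp ((x : ℝ) * (y : ℕ) / N) =
        ∑ x ∈ Finset.range N, if x ∈ X then u x * unitExp ((x : ℝ) * (y : ℕ) / N) else 0 := by
      rw [Finset.sum_ite_mem, Finset.inter_eq_right.2 hX]
    rw [h3, ← Fin.sum_univ_eq_sum_range
      (fun x => if x ∈ X then u x * unitExp ((x : ℝ) * (y : ℕ) / N) else 0), Finset.mul_sum,
      Matrix.mulVec, dotProduct]
    refine Finset.sum_congr rfl fun x _ => ?_
    rw [fourierMatrix_conjTranspose_apply, mul_comm ((y : ℕ) : ℝ)]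
    split_ifs <;> ring
  have h4 : ∑ x : Fin N, ‖if (x : ℕ) ∈ X then u x else 0‖ ^ 2 = ∑ x ∈ X, ‖u x‖ ^ 2 := by
    rw [Fin.sum_univ_eq_sum_range (fun x => ‖if x ∈ X then u x else 0‖ ^ 2)]
    have : ∀ x, ‖if x ∈ X then u x else 0‖ ^ 2 = if x ∈ X then ‖u x‖ ^ 2 else 0 := by
      intro x
      split_ifs <;> simp
    simp only [this]
    rw [Finset.sum_ite_mem, Finset.inter_eq_right.2 hX]
  rw [h4] at h1
  simp only [h2, norm_mul, mul_pow] at h1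
  rw [← Finset.mul_sum, Fin.sum_univ_eq_sum_range
    (fun y => ‖∑ x ∈ X, u x * unitExp ((x : ℝ) * y / N)‖ ^ 2), Complex.norm_real, Real.norm_eq_abs,
    sq_abs, div_pow, one_pow, Real.sq_sqrt hN'.le, one_div, inv_mul_le_iff₀ hN'] at h1
  refine h1.trans ?_
  gcongr
  refine mul_le_of_le_one_left (Finset.sum_nonneg fun _ _ => by positivity) ?_
  exact pow_le_one₀ (norm_nonneg _) (norm_fourierMatrix_conjTranspose_le_one N)

lemma fourierBound_of_subset_range {X : Finset ℕ} {N : ℕ} (hX : X ⊆ Finset.range N) :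
    FourierBound X N N := fun u =>
  (Finset.sum_le_sum_of_subset_of_nonneg hX fun _ _ _ => by positivity).trans
    (sum_range_norm_sq_le hX u)

/-- A strict inequality for each nonzero vector improves to a smaller uniform constant. -/
lemma exists_fourierBound_lt {X : Finset ℕ} {N : ℕ} {K : ℝ} (hK : 0 < K)
    (h : ∀ u : ℕ → ℂ, (∃ x ∈ X, u x ≠ 0) →
      ∑ y ∈ X, ‖∑ x ∈ X, u x * unitExp ((x : ℝ) * y / N)‖ ^ 2 < K * ∑ x ∈ X, ‖u x‖ ^ 2) :
    ∃ K', 0 ≤ K' ∧ K' < K ∧ FourierBound X N K' := by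
  rcases X.eq_empty_or_nonempty with rfl | ⟨x₀, hx₀⟩
  · exact ⟨0, le_rfl, hK, fun u => by simp⟩
  -- Compactness: the quadratic form attains its maximum on the unit sphere of `ℓ²(X)`, and that
  -- maximum is the constant sought.
  let ext : EuclideanSpace ℂ X → ℕ → ℂ := fun v x => if hx : x ∈ X then v ⟨x, hx⟩ else 0
  let φ : EuclideanSpace ℂ X → ℝ := fun v =>
    ∑ y ∈ X, ‖∑ x ∈ X, ext v x * unitExp ((x : ℝ) * y / N)‖ ^ 2
  have hext : ∀ x, Continuous fun v => ext v x := by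
    intro x
    by_cases hx : x ∈ X
    · simp only [ext, hx, dite_true]
      fun_prop
    · simp only [ext, hx, dite_false]
      fun_prop
  have hφ : Continuous φ := by
    refine continuous_finsetSum _ fun y _ => Continuous.pow (Continuous.norm ?_) 2
    exact continuous_finsetSum _ fun x _ => (hext x).mul continuous_const
  have hnorm : ∀ v, ∑ x ∈ X, ‖ext v x‖ ^ 2 = ‖v‖ ^ 2 := by
    intro v
    rw [EuclideanSpace.norm_sq_eq, ← Finset.sum_coe_sort X]
    refine Finset.sum_congr rfl fun x _ => ?_
    simp [ext]
  have hne : (Metric.sphere (0 : EuclideanSpace ℂ X) 1).Nonempty :=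
    ⟨EuclideanSpace.single ⟨x₀, hx₀⟩ 1, by simp⟩
  obtain ⟨v, hv, hmax⟩ := (isCompact_sphere (0 : EuclideanSpace ℂ X) 1).exists_isMaxOn hne
    hφ.continuousOn
  have hv1 : ‖v‖ = 1 := by simpa using hv
  refine ⟨φ v, Finset.sum_nonneg fun _ _ => by positivity, ?_, fun u => ?_⟩
  · have h1 := h (ext v) ?_
    · rw [hnorm, hv1, one_pow, mul_one] at h1
      exact h1
    · by_contra! hcon
      have h2 := hnorm v
      rw [Finset.sum_eq_zero fun x hx => by rw [hcon x hx]; simp, hv1] at h2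
      norm_num at h2
  · set w : EuclideanSpace ℂ X := WithLp.toLp 2 fun x => u x with hw
    have hwu : ∀ x ∈ X, ext w x = u x := fun x hx => by simp [ext, hx, hw]
    have h1 : ∑ x ∈ X, ‖u x‖ ^ 2 = ‖w‖ ^ 2 := by
      rw [← hnorm]
      exact Finset.sum_congr rfl fun x hx => by rw [hwu x hx]
    have h2 : ∑ y ∈ X, ‖∑ x ∈ X, u x * unitExp ((x : ℝ) * y / N)‖ ^ 2 = φ w := by
      refine Finset.sum_congr rfl fun y _ => ?_
      congr 2
      exact Finset.sum_congr rfl fun x hx => by rw [hwu x hx]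
    rw [h1, h2]
    by_cases hw0 : w = 0
    · simp [hw0, φ, ext]
    have hwn : ‖w‖ ≠ 0 := norm_ne_zero_iff.2 hw0
    have h3 : φ w = φ (((‖w‖⁻¹ : ℝ) : ℂ) • w) * ‖w‖ ^ 2 := by
      have h4 : ∀ x, ext (((‖w‖⁻¹ : ℝ) : ℂ) • w) x = ((‖w‖⁻¹ : ℝ) : ℂ) * ext w x := by
        intro x
        by_cases hx : x ∈ X <;> simp [ext, hx]
      simp only [φ, h4, mul_assoc, ← Finset.mul_sum, norm_mul, mul_pow, Complex.norm_real,
        norm_inv, norm_norm]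
      rw [mul_comm, mul_assoc, ← mul_pow, mul_inv_cancel₀ hwn, one_pow, mul_one]
    rw [h3]
    gcongr
    refine hmax ?_
    rw [mem_sphere_zero_iff_norm, norm_smul, Complex.norm_real, norm_inv, norm_norm,
      inv_mul_cancel₀ hwn]

/-- A nonzero function on `X` has a Fourier transform that cannot vanish on `|X|` consecutive
points. -/
lemma exists_sum_unitExp_ne_zero {X : Finset ℕ} {N : ℕ} (hX : X ⊆ Finset.range N) {u : ℕ → ℂ}
    (hu : ∃ x ∈ X, u x ≠ 0) (y₀ : ℕ) :
    ∃ i < X.card, ∑ x ∈ X, u x * unitExp ((x : ℝ) * ((y₀ + i : ℕ) : ℝ) / N) ≠ 0 := by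
  by_contra! hcon
  obtain ⟨x₀, hx₀, hux₀⟩ := hu
  have hN : (N : ℝ) ≠ 0 := by
    have := Finset.mem_range.1 (hX hx₀)
    exact_mod_cast (by omega : N ≠ 0)
  let e := X.equivFin.symm
  have hinj : Function.Injective fun j : Fin X.card => unitExp (((e j : ℕ) : ℝ) / N) := by
    intro i j hij
    have hij' : unitExp (((e i : ℕ) : ℝ) / N) = unitExp (((e j : ℕ) : ℝ) / N) := hij
    have h1 : unitExp (((e i : ℕ) : ℝ) / N - ((e j : ℕ) : ℝ) / N) = 1 := by
      rw [unitExp_sub, hij', ← unitExp_add, add_neg_cancel, unitExp_zero]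
    obtain ⟨n, hn⟩ := (unitExp_eq_one_iff _).1 h1
    rw [← sub_div, div_eq_iff hN] at hn
    have hn' : ((e i : ℕ) : ℤ) - ((e j : ℕ) : ℤ) = n * N := by exact_mod_cast hn
    have h2 := Finset.mem_range.1 (hX (e i).2)
    have h3 := Finset.mem_range.1 (hX (e j).2)
    have h4 := Int.eq_zero_of_abs_lt_dvd (⟨n, by rw [hn', mul_comm]⟩ :
      (N : ℤ) ∣ ((e i : ℕ) : ℤ) - ((e j : ℕ) : ℤ)) (by rw [abs_lt]; omega)
    exact e.injective (Subtype.ext (by omega))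
  -- Vandermonde system with distinct nodes `unitExp (x / N)`; the starting point `y₀` is absorbed
  -- into the unknown vector.
  have h := Matrix.eq_zero_of_forall_pow_sum_mul_pow_eq_zero hinj
    (v := fun j => u (e j) * unitExp (((e j : ℕ) : ℝ) * y₀ / N)) ?_
  · have h1 := congrFun h (e.symm ⟨x₀, hx₀⟩)
    simp only [Equiv.apply_symm_apply, Pi.zero_apply, mul_eq_zero] at h1
    exact h1.elim hux₀ (unitExp_ne_zero _)
  · intro i
    have h1 := hcon i i.2
    rw [← Finset.sum_coe_sort X, ← e.sum_comp] at h1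
    rw [← h1]
    refine Finset.sum_congr rfl fun j _ => ?_
    rw [← unitExp_nat_mul, mul_assoc, ← unitExp_add]
    congr 2
    push_cast
    ring

/-- The lack of a pair of nonzero functions on a sparse Cantor set which are Fourier transforms of
each other. -/
lemma exists_fourierBound_lt_pow {M : ℕ} {A : Finset ℕ} (hA : A ⊆ Finset.range M)
    (hlt : A.card < M) :
    ∃ k, 0 < k ∧ ∃ K, 0 ≤ K ∧ K < (M : ℝ) ^ k ∧ FourierBound (cantorFinset M A k) (M ^ k) K := by
  have hM : 0 < M := by omega
  have hM' : (0 : ℝ) < M := by exact_mod_cast hM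
  obtain ⟨k, hk⟩ := exists_pow_lt_of_lt_one (x := 1 / (M : ℝ)) (y := A.card / M) (by positivity)
    ((div_lt_one hM').2 (by exact_mod_cast hlt))
  -- The integers with leading digit `a ∉ A` form `M ^ k` consecutive points off the Cantor set of
  -- order `k + 1`. This inequality makes the gap at least as long as the set has elements, so the
  -- transform is nonzero somewhere in it and Bessel's inequality becomes strict.
  have hcard : A.card ^ (k + 1) ≤ M ^ k := by
    have h1 : (A.card : ℝ) ^ k * M < M ^ k := by
      rw [div_pow, div_lt_div_iff₀ (by positivity) hM', one_mul] at hk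
      exact hk
    have h2 : A.card ^ k * M < M ^ k := by exact_mod_cast h1
    rw [pow_succ]
    exact (Nat.mul_le_mul_left _ hlt.le).trans h2.le
  obtain ⟨a, haM, haA⟩ : ∃ a ∈ Finset.range M, a ∉ A := by
    by_contra! hcon
    have := Finset.card_le_card hcon
    rw [Finset.card_range] at this
    omega
  refine ⟨k + 1, by omega, exists_fourierBound_lt (by positivity) fun u hu => ?_⟩
  have hsub := cantorFinset_subset_range M A (k + 1)
  obtain ⟨i, hi, hne⟩ := exists_sum_unitExp_ne_zero hsub hu (a * M ^ k)
  rw [card_cantorFinset hM hA] at hi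
  have hi' : i < M ^ k := hi.trans_le hcard
  have hy : a * M ^ k + i ∈ Finset.range (M ^ (k + 1)) := by
    rw [Finset.mem_range] at haM ⊢
    calc a * M ^ k + i < a * M ^ k + M ^ k := by omega
      _ = (a + 1) * M ^ k := by ring
      _ ≤ M * M ^ k := Nat.mul_le_mul_right _ haM
      _ = M ^ (k + 1) := by ring
  have hyC : a * M ^ k + i ∉ cantorFinset M A (k + 1) := by
    intro hmem
    have := (mem_cantorFinset.1 hmem).2 k (by omega)
    rw [mul_comm, Nat.mul_add_div (by positivity), Nat.div_eq_of_lt hi', add_zero,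
      Nat.mod_eq_of_lt (Finset.mem_range.1 haM)] at this
    exact haA this
  have h1 := sum_range_norm_sq_le hsub u
  push_cast at h1 hne ⊢
  refine lt_of_lt_of_le ?_ h1
  refine Finset.sum_lt_sum_of_subset hsub hy hyC ?_ fun _ _ _ => by positivity
  have := norm_pos_iff.2 hne
  push_cast
  positivity

/-- Expanding the squares gives the exact defect in Cauchy–Schwarz, hence its equality case. -/
lemma sum_sum_norm_sub_sq {ι : Type*} (s : Finset ι) (z : ι → ℂ) :
    ∑ i ∈ s, ∑ j ∈ s, ‖z i - z j‖ ^ 2 =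
      2 * (s.card * ∑ i ∈ s, ‖z i‖ ^ 2 - ‖∑ i ∈ s, z i‖ ^ 2) := by
  have h : ∀ i j, ‖z i - z j‖ ^ 2 = ‖z i‖ ^ 2 + ‖z j‖ ^ 2 - 2 * inner ℝ (z i) (z j) := by
    intro i j
    rw [norm_sub_sq_real]
    ring
  simp only [h, Finset.sum_sub_distrib, Finset.sum_add_distrib, Finset.sum_const, ← Finset.mul_sum,
    nsmul_eq_mul, ← inner_sum, ← sum_inner, real_inner_self_eq_norm_sq]
  ring

/-- The Fourier matrix localized to the Cantor set of order two does not have rank one, so its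
operator norm is smaller than its Hilbert–Schmidt norm. -/
lemma exists_fourierBound_lt_card {M : ℕ} {A : Finset ℕ} (hA : A ⊆ Finset.range M)
    (hgt : 1 < A.card) :
    ∃ K, 0 ≤ K ∧ K < (A.card : ℝ) ^ 4 ∧ FourierBound (cantorFinset M A 2) (M ^ 2) K := by
  obtain ⟨a, ha, b, hb, hab⟩ := Finset.one_lt_card.1 hgt
  have haM := Finset.mem_range.1 (hA ha)
  have hbM := Finset.mem_range.1 (hA hb)
  have hM : 0 < M := by omega
  have hA0 : 0 < A.card := by omega
  refine exists_fourierBound_lt (by positivity) fun u hu => ?_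
  set C := cantorFinset M A 2 with hC
  have hcard : (C.card : ℝ) = (A.card : ℝ) ^ 2 := by
    rw [hC, card_cantorFinset hM hA]
    push_cast
    rfl
  have hmem : ∀ {p q}, p ∈ A → q ∈ A → M * p + q ∈ C := by
    intro p q hp hq
    have hq' := Finset.mem_range.1 (hA hq)
    have := (mul_add_mem_cantorFinset hM (A := A) (k := 1) (l := 1) (a := p) (b := q)
      (by simpa using hq')).2
    rw [cantorFinset_one hA, pow_one] at this
    exact this ⟨hp, hq⟩
  have hle : ∀ y, ‖∑ x ∈ C, u x * unitExp ((x : ℝ) * y / ((M ^ 2 : ℕ) : ℝ))‖ ^ 2 =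
      C.card * ∑ x ∈ C, ‖u x‖ ^ 2 - (1 / 2) * ∑ x ∈ C, ∑ x' ∈ C,
        ‖u x * unitExp ((x : ℝ) * y / ((M ^ 2 : ℕ) : ℝ)) -
          u x' * unitExp ((x' : ℝ) * y / ((M ^ 2 : ℕ) : ℝ))‖ ^ 2 := by
    intro y
    rw [sum_sum_norm_sub_sq]
    simp only [norm_mul, norm_unitExp, mul_one]
    ring
  have hnn : ∀ y : ℕ, 0 ≤ ∑ x ∈ C, ∑ x' ∈ C, ‖u x * unitExp ((x : ℝ) * y / ((M ^ 2 : ℕ) : ℝ)) -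
      u x' * unitExp ((x' : ℝ) * y / ((M ^ 2 : ℕ) : ℝ))‖ ^ 2 := fun y =>
    Finset.sum_nonneg fun _ _ => Finset.sum_nonneg fun _ _ => by positivity
  have htot : (A.card : ℝ) ^ 4 * ∑ x ∈ C, ‖u x‖ ^ 2 = ∑ y ∈ C, C.card * ∑ x ∈ C, ‖u x‖ ^ 2 := by
    rw [Finset.sum_const, nsmul_eq_mul, hcard]
    ring
  rw [htot]
  simp only [hle]
  by_contra hcon
  -- Equality with the Hilbert–Schmidt bound forces equality in Cauchy–Schwarz in every row, so all
  -- terms of a row coincide.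
  have heq : ∀ y ∈ C, ∀ x ∈ C, ∀ x' ∈ C, u x * unitExp ((x : ℝ) * y / ((M ^ 2 : ℕ) : ℝ)) =
      u x' * unitExp ((x' : ℝ) * y / ((M ^ 2 : ℕ) : ℝ)) := by
    intro y hy x hx x' hx'
    by_contra hne
    refine hcon (Finset.sum_lt_sum (fun y _ => by linarith [hnn y]) ⟨y, hy, ?_⟩)
    have hpos : 0 < ∑ x ∈ C, ∑ x' ∈ C, ‖u x * unitExp ((x : ℝ) * y / ((M ^ 2 : ℕ) : ℝ)) -
        u x' * unitExp ((x' : ℝ) * y / ((M ^ 2 : ℕ) : ℝ))‖ ^ 2 := by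
      refine Finset.sum_pos' (fun _ _ => Finset.sum_nonneg fun _ _ => by positivity) ⟨x, hx, ?_⟩
      refine Finset.sum_pos' (fun _ _ => by positivity) ⟨x', hx', ?_⟩
      have := norm_pos_iff.2 (sub_ne_zero.2 hne)
      positivity
    linarith
  have hp := hmem ha ha
  have hq := hmem ha hb
  obtain ⟨x₀, hx₀, hux₀⟩ := hu
  have hu_ne : ∀ x ∈ C, u x ≠ 0 := by
    intro x hx h0
    have := heq x₀ hx₀ x hx x₀ hx₀
    rw [h0, zero_mul] at this
    exact mul_ne_zero hux₀ (unitExp_ne_zero _) this.symm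
  -- The minor on rows and columns `p, q` would vanish, giving `unitExp ((p - q) ^ 2 / M ^ 2) = 1`,
  -- which is impossible since `0 < |p - q| < M`. At order one the denominator would be `M`, which
  -- may divide `(a - b) ^ 2`.
  set p := M * a + a with hp_def
  set q := M * a + b with hq_def
  have e1 := heq p hp p hp q hq
  have e2 := heq q hq p hp q hq
  have e3 : (u p * u q) *
      (unitExp ((p : ℝ) * p / ((M ^ 2 : ℕ) : ℝ)) * unitExp ((q : ℝ) * q / ((M ^ 2 : ℕ) : ℝ))) =
      (u p * u q) *
      (unitExp ((q : ℝ) * p / ((M ^ 2 : ℕ) : ℝ)) * unitExp ((p : ℝ) * q / ((M ^ 2 : ℕ) : ℝ))) := by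
    linear_combination (u q * unitExp ((q : ℝ) * q / ((M ^ 2 : ℕ) : ℝ))) * e1 -
      (u q * unitExp ((q : ℝ) * p / ((M ^ 2 : ℕ) : ℝ))) * e2
  have e4 := mul_left_cancel₀ (mul_ne_zero (hu_ne p hp) (hu_ne q hq)) e3
  rw [← unitExp_add, ← unitExp_add] at e4
  have e5 : unitExp ((p : ℝ) * p / ((M ^ 2 : ℕ) : ℝ) + (q : ℝ) * q / ((M ^ 2 : ℕ) : ℝ) -
      ((q : ℝ) * p / ((M ^ 2 : ℕ) : ℝ) + (p : ℝ) * q / ((M ^ 2 : ℕ) : ℝ))) = 1 := by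
    rw [unitExp_sub, e4, ← unitExp_add, add_neg_cancel, unitExp_zero]
  obtain ⟨n, hn⟩ := (unitExp_eq_one_iff _).1 e5
  have hM' : (M : ℝ) ≠ 0 := by exact_mod_cast hM.ne'
  have e6 : ((a : ℝ) - b) ^ 2 = M ^ 2 * n := by
    rw [hp_def, hq_def] at hn
    push_cast at hn
    field_simp at hn
    linear_combination hn
  have e7 : ((a : ℤ) - b) ^ 2 = (M : ℤ) ^ 2 * n := by exact_mod_cast e6
  have e8 := Int.eq_zero_of_abs_lt_dvd (⟨n, e7⟩ : (M : ℤ) ^ 2 ∣ ((a : ℤ) - b) ^ 2) (by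
    rw [abs_pow, sq_abs, sq_lt_sq, abs_of_nonneg (Int.natCast_nonneg M), abs_lt]
    omega)
  rw [sq_eq_zero_iff] at e8
  omega

/-- The fractal uncertainty principle for discrete Cantor sets, with an exponent strictly better
than the trivial one. -/
theorem exists_cantorFinset_uncertainty {M : ℕ} {A : Finset ℕ} (hA : A ⊆ Finset.range M)
    (hgt : 1 < A.card) (hlt : A.card < M) :
    ∃ β : ℝ, max 0 (1 / 2 - Real.log (A.card : ℝ) / Real.log (M : ℝ)) < β ∧ β < 1 / 2 ∧
      ∃ C : ℝ, 0 < C ∧ ∀ k : ℕ, FourierBound (cantorFinset M A k) (M ^ k)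
        (C * ((M : ℝ) ^ (1 - 2 * β)) ^ k) := by
  have hM : 0 < M := by omega
  have hM1 : (1 : ℝ) < M := by exact_mod_cast (by omega : 1 < M)
  have hM0 : (0 : ℝ) < M := by linarith
  have hA1 : (1 : ℝ) < A.card := by exact_mod_cast hgt
  have hA0 : (0 : ℝ) < A.card := by linarith
  have hlogM := Real.log_pos hM1
  have hlogA := Real.log_pos hA1
  obtain ⟨k, hk, K, hK0, hKlt, hK⟩ := exists_fourierBound_lt_pow hA hlt
  obtain ⟨K', hK0', hKlt', hK'⟩ := exists_fourierBound_lt_card hA hgt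
  -- A common order for both improvements: `K` lives at order `k` and `K'` at order `2`.
  set q := 2 * k with hq
  have hb1 : FourierBound (cantorFinset M A q) (M ^ q) (K ^ 2) := by
    rw [hq, mul_comm]
    exact hK.cantorFinset_mul hM hK0 2
  have hb2 : FourierBound (cantorFinset M A q) (M ^ q) (K' ^ k) := hK'.cantorFinset_mul hM hK0' k
  obtain ⟨κ, hκ0, hκ1, hκ2, hκ⟩ : ∃ κ : ℝ, 0 ≤ κ ∧ κ < M ^ q ∧ κ < (A.card : ℝ) ^ (2 * q) ∧
      FourierBound (cantorFinset M A q) (M ^ q) κ := by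
    have h1 : K ^ 2 < (M : ℝ) ^ q := by
      calc K ^ 2 < ((M : ℝ) ^ k) ^ 2 := by gcongr
        _ = (M : ℝ) ^ q := by rw [← pow_mul, hq, mul_comm]
    have h2 : K' ^ k < (A.card : ℝ) ^ (2 * q) := by
      calc K' ^ k < ((A.card : ℝ) ^ 4) ^ k := by
            exact pow_lt_pow_left₀ hKlt' hK0' hk.ne'
        _ = (A.card : ℝ) ^ (2 * q) := by rw [← pow_mul, hq, ← mul_assoc]; norm_num
    rcases le_total (K ^ 2) (K' ^ k) with h | h
    · exact ⟨K ^ 2, by positivity, h1, h.trans_lt h2, hb1⟩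
    · exact ⟨K' ^ k, by positivity, h.trans_lt h1, h2, hb2⟩
  set m := max 0 (1 / 2 - Real.log (A.card : ℝ) / Real.log (M : ℝ)) with hm
  have hm2 : m < 1 / 2 := by
    refine max_lt (by norm_num) ?_
    have : 0 < Real.log (A.card : ℝ) / Real.log (M : ℝ) := by positivity
    linarith
  -- `M ^ (1 - 2 * m)` equals `M` or `|A| ^ 2` according to which term of the maximum is chosen; `κ`
  -- beats both. Continuity in the exponent then leaves room for some `β > m`.
  have hκm : κ < ((M : ℝ) ^ (1 - 2 * m)) ^ q := by
    rcases max_choice 0 (1 / 2 - Real.log (A.card : ℝ) / Real.log (M : ℝ)) with h | h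
    · rw [hm, h, mul_zero, sub_zero, Real.rpow_one]
      exact hκ1
    · have e : (M : ℝ) ^ (1 - 2 * m) = (A.card : ℝ) ^ 2 := by
        rw [Real.rpow_def_of_pos hM0, hm, h]
        have : Real.log M * (1 - 2 * (1 / 2 - Real.log (A.card : ℝ) / Real.log (M : ℝ))) =
            (2 : ℕ) * Real.log A.card := by
          push_cast
          field_simp
          ring
        rw [this, Real.exp_nat_mul, Real.exp_log hA0]
      rw [e, ← pow_mul]
      exact hκ2
  obtain ⟨β, hβκ, hβ2, hβm⟩ : ∃ β : ℝ, κ < ((M : ℝ) ^ (1 - 2 * β)) ^ q ∧ β < 1 / 2 ∧ m < β := by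
    have hcont : Continuous fun β : ℝ => ((M : ℝ) ^ (1 - 2 * β)) ^ q :=
      (Continuous.rpow continuous_const (by fun_prop) fun _ => Or.inl hM0.ne').pow q
    have h1 : ∀ᶠ β in nhdsWithin m (Set.Ioi m), κ < ((M : ℝ) ^ (1 - 2 * β)) ^ q :=
      (hcont.continuousAt.eventually (lt_mem_nhds hκm)).filter_mono nhdsWithin_le_nhds
    have h2 : ∀ᶠ β in nhdsWithin m (Set.Ioi m), β < 1 / 2 :=
      (eventually_lt_nhds hm2).filter_mono nhdsWithin_le_nhds
    obtain ⟨β, h⟩ := (h1.and (h2.and (eventually_mem_nhdsWithin))).exists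
    exact ⟨β, h⟩
  -- The constant `M ^ q` pays for the last `n % q` digits, estimated trivially.
  refine ⟨β, hβm, hβ2, (M : ℝ) ^ q, by positivity, fun n => ?_⟩
  set t := (M : ℝ) ^ (1 - 2 * β) with ht
  have ht1 : 1 ≤ t := Real.one_le_rpow hM1.le (by linarith)
  have hr := fourierBound_of_subset_range (cantorFinset_subset_range M A (n % q))
  have h := FourierBound.cantorFinset_add hM (by positivity) (hκ.cantorFinset_mul hM hκ0 (n / q)) hr
  rw [Nat.div_add_mod] at h
  refine h.mono ?_
  have hq0 : 0 < q := by omega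
  calc κ ^ (n / q) * ((M ^ (n % q) : ℕ) : ℝ) ≤ (t ^ q) ^ (n / q) * (M : ℝ) ^ q := by
        push_cast
        gcongr
        · exact hM1.le
        · exact (Nat.mod_lt _ hq0).le
    _ ≤ t ^ n * (M : ℝ) ^ q := by
        rw [← pow_mul]
        gcongr ?_ * _
        exact pow_le_pow_right₀ ht1 (Nat.mul_div_le n q)
    _ = _ := mul_comm _ _

/-! ### Stability of the uncertainty principle under shifts and coverings. -/

/-- The extra phases depend on `x` alone or on `y` alone: the former is absorbed into `u`, the
latter disappears under the modulus. -/
lemma FourierBound.shift {X : Finset ℕ} {N : ℕ} {K : ℝ} (h : FourierBound X N K) (u : ℕ → ℂ)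
    (σ τ : ℝ) :
    ∑ y ∈ X, ‖∑ x ∈ X, u x * unitExp ((x + σ) * (y + τ) / N)‖ ^ 2 ≤ K * ∑ x ∈ X, ‖u x‖ ^ 2 := by
  have h1 : ∀ y, ‖∑ x ∈ X, u x * unitExp ((x + σ) * (y + τ) / N)‖ =
      ‖∑ x ∈ X, (u x * unitExp (x * τ / N)) * unitExp ((x : ℝ) * y / N)‖ := by
    intro y
    have : ∑ x ∈ X, u x * unitExp ((x + σ) * (y + τ) / N) = unitExp (σ * (y + τ) / N) *
        ∑ x ∈ X, (u x * unitExp (x * τ / N)) * unitExp ((x : ℝ) * y / N) := by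
      rw [Finset.mul_sum]
      refine Finset.sum_congr rfl fun x _ => ?_
      have : ((x + σ) * (y + τ) / N : ℝ) = σ * (y + τ) / N + x * τ / N + x * y / N := by ring
      rw [this, unitExp_add, unitExp_add]
      ring
    rw [this, norm_mul, norm_unitExp, one_mul]
  simp only [h1]
  refine (h _).trans (le_of_eq ?_)
  simp only [norm_mul, norm_unitExp, mul_one]

lemma FourierBound.of_injOn {X Y Z : Finset ℕ} {N : ℕ} {K : ℝ} (h : FourierBound X N K)
    (u : ℕ → ℂ) (σ τ : ℝ) (φ ψ : ℕ → ℕ) (hφ : ∀ y ∈ Y, φ y ∈ X) (hψ : ∀ z ∈ Z, ψ z ∈ X)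
    (hφσ : ∀ y ∈ Y, (y : ℝ) = φ y + σ) (hψτ : ∀ z ∈ Z, (z : ℝ) = ψ z + τ) :
    ∑ z ∈ Z, ‖∑ y ∈ Y, u y * unitExp ((y : ℝ) * z / N)‖ ^ 2 ≤ K * ∑ y ∈ Y, ‖u y‖ ^ 2 := by
  have hφi : Set.InjOn φ Y := by
    intro a ha b hb hab
    have h1 := hφσ a ha
    rw [hab, ← hφσ b hb] at h1
    exact_mod_cast h1
  have hψi : Set.InjOn ψ Z := by
    intro a ha b hb hab
    have h1 := hψτ a ha
    rw [hab, ← hψτ b hb] at h1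
    exact_mod_cast h1
  set w : ℕ → ℂ := fun x => ∑ y ∈ Y with φ y = x, u y with hw
  have hwφ : ∀ y ∈ Y, w (φ y) = u y := by
    intro y hy
    rw [hw]
    simp only
    rw [Finset.sum_eq_single y]
    · intro b hb hby
      rw [Finset.mem_filter] at hb
      exact absurd (hφi hb.1 hy hb.2) hby
    · intro hy'
      simp [hy] at hy'
  have hw0 : ∀ x ∈ X, x ∉ Y.image φ → w x = 0 := by
    intro x _ hx
    rw [hw]
    refine Finset.sum_eq_zero fun y hy => ?_
    rw [Finset.mem_filter] at hy
    exact absurd (Finset.mem_image.2 ⟨y, hy⟩) hx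
  have hsub : Y.image φ ⊆ X := Finset.image_subset_iff.2 hφ
  have hnorm : ∑ x ∈ X, ‖w x‖ ^ 2 = ∑ y ∈ Y, ‖u y‖ ^ 2 := by
    rw [← Finset.sum_subset hsub fun x hx hx' => by rw [hw0 x hx hx']; simp,
      Finset.sum_image hφi]
    exact Finset.sum_congr rfl fun y hy => by rw [hwφ y hy]
  have hsum : ∀ z ∈ Z, ∑ y ∈ Y, u y * unitExp ((y : ℝ) * z / N) =
      ∑ x ∈ X, w x * unitExp ((x + σ) * ((ψ z : ℕ) + τ) / N) := by
    intro z hz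
    rw [← Finset.sum_subset hsub fun x hx hx' => by rw [hw0 x hx hx', zero_mul],
      Finset.sum_image hφi]
    exact Finset.sum_congr rfl fun y hy => by rw [hwφ y hy, ← hφσ y hy, ← hψτ z hz]
  rw [← hnorm]
  refine le_trans ?_ (h.shift w σ τ)
  rw [Finset.sum_congr rfl fun z hz => by rw [hsum z hz],
    ← Finset.sum_image (f := fun x : ℕ => ‖∑ x_1 ∈ X, w x_1 *
      unitExp ((x_1 + σ) * ((x : ℝ) + τ) / N)‖ ^ 2) hψi]
  exact Finset.sum_le_sum_of_subset_of_nonneg (Finset.image_subset_iff.2 hψ)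
    fun _ _ _ => by positivity

/-- A set covered by `T` shifts of `X` satisfies the bound for `X` with a loss of `T ^ 2`. -/
lemma FourierBound.of_cover {X Y : Finset ℕ} {N R T : ℕ} {K : ℝ} (h : FourierBound X N K)
    (hcov : ∀ y ∈ Y, ∃ x ∈ X, ∃ t < T, y + R = x + t) :
    FourierBound Y N (T ^ 2 * K) := by
  -- Both variables are sorted by the shift `θ`. One factor `T` is Cauchy–Schwarz over the input
  -- pieces, the other counts the output pieces.
  choose! φ hφ θ hθ hφθ using hcov
  intro u
  have hmaps : ∀ y ∈ Y, θ y ∈ Finset.range T := fun y hy => Finset.mem_range.2 (hθ y hy)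
  have hpiece : ∀ s t : ℕ, ∑ z ∈ Y with θ z = s, ‖∑ y ∈ Y with θ y = t,
      u y * unitExp ((y : ℝ) * z / N)‖ ^ 2 ≤ K * ∑ y ∈ Y with θ y = t, ‖u y‖ ^ 2 := by
    intro s t
    have key : ∀ t, ∀ y ∈ Y.filter (fun y => θ y = t), (y : ℝ) = φ y + ((t : ℝ) - R) := by
      intro t y hy
      rw [Finset.mem_filter] at hy
      have h1 := hφθ y hy.1
      rw [hy.2] at h1
      have h2 : (y : ℝ) + R = φ y + t := by exact_mod_cast h1
      linarith
    exact h.of_injOn u _ _ φ φ (fun y hy => hφ y (Finset.mem_filter.1 hy).1)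
      (fun y hy => hφ y (Finset.mem_filter.1 hy).1) (key t) (key s)
  have hnorm : ∀ z : ℕ, ‖∑ y ∈ Y, u y * unitExp ((y : ℝ) * z / N)‖ ^ 2 ≤
      T * ∑ t ∈ Finset.range T, ‖∑ y ∈ Y with θ y = t, u y * unitExp ((y : ℝ) * z / N)‖ ^ 2 := by
    intro z
    rw [← Finset.sum_fiberwise_of_maps_to hmaps]
    refine (pow_le_pow_left₀ (norm_nonneg _) (norm_sum_le _ _) 2).trans ?_
    refine sq_sum_le_card_mul_sum_sq.trans (le_of_eq ?_)
    rw [Finset.card_range]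
  calc ∑ z ∈ Y, ‖∑ y ∈ Y, u y * unitExp ((y : ℝ) * z / N)‖ ^ 2
      ≤ ∑ z ∈ Y, T * ∑ t ∈ Finset.range T,
          ‖∑ y ∈ Y with θ y = t, u y * unitExp ((y : ℝ) * z / N)‖ ^ 2 :=
        Finset.sum_le_sum fun z _ => hnorm z
    _ = T * ∑ t ∈ Finset.range T, ∑ s ∈ Finset.range T, ∑ z ∈ Y with θ z = s,
          ‖∑ y ∈ Y with θ y = t, u y * unitExp ((y : ℝ) * z / N)‖ ^ 2 := by
        rw [← Finset.mul_sum, Finset.sum_comm]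
        congr 1
        refine Finset.sum_congr rfl fun t _ => ?_
        rw [Finset.sum_fiberwise_of_maps_to hmaps]
    _ ≤ T * ∑ t ∈ Finset.range T, ∑ s ∈ Finset.range T,
          K * ∑ y ∈ Y with θ y = t, ‖u y‖ ^ 2 := by
        gcongr with t _ s _
        exact hpiece s t
    _ = T ^ 2 * K * ∑ y ∈ Y, ‖u y‖ ^ 2 := by
        simp only [Finset.sum_const, Finset.card_range, nsmul_eq_mul]
        rw [← Finset.mul_sum, ← Finset.mul_sum, Finset.sum_fiberwise_of_maps_to hmaps]
        ring

/-! ### Propagation through powers and the abstract eigenvalue estimate. -/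

/-- The multiplication operator by the indicator function of `S`. -/
def indicatorMatrix {n : Type*} [DecidableEq n] (S : Set n) : Matrix n n ℂ :=
  Matrix.diagonal (S.indicator 1)

section Indicator

variable {n : Type*} [Fintype n] [DecidableEq n]

omit [Fintype n] in
lemma indicatorMatrix_add_compl (S : Set n) :
    indicatorMatrix S + indicatorMatrix Sᶜ = (1 : Matrix n n ℂ) := by
  rw [indicatorMatrix, indicatorMatrix, Matrix.diagonal_add, ← Matrix.diagonal_one]
  congr 1
  ext i
  exact congrFun (Set.indicator_self_add_compl S (1 : n → ℂ)) i

omit [Fintype n] in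
lemma indicatorMatrix_conjTranspose (S : Set n) :
    (indicatorMatrix S)ᴴ = (indicatorMatrix S : Matrix n n ℂ) := by
  classical
  rw [indicatorMatrix, Matrix.diagonal_conjTranspose]
  congr 1
  ext i
  by_cases h : i ∈ S <;> simp [h]

lemma norm_indicatorMatrix_le_one (S : Set n) : ‖(indicatorMatrix S : Matrix n n ℂ)‖ ≤ 1 := by
  rw [indicatorMatrix, Matrix.l2_opNorm_diagonal, pi_norm_le_iff_of_nonneg zero_le_one]
  intro i
  by_cases h : i ∈ S <;> simp [h]

lemma indicatorMatrix_mul_mul_apply (S T : Set n) (G : Matrix n n ℂ) (i j : n) :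
    (indicatorMatrix S * G * indicatorMatrix T) i j =
      S.indicator 1 i * G i j * T.indicator 1 j := by
  rw [indicatorMatrix, indicatorMatrix, Matrix.mul_diagonal, Matrix.diagonal_mul]

lemma norm_pow_le_one_of_norm_le_one {G : Matrix n n ℂ} (hG : ‖G‖ ≤ 1) (k : ℕ) : ‖G ^ k‖ ≤ 1 := by
  rcases isEmpty_or_nonempty n with h | h
  · rw [Subsingleton.elim (G ^ k) 0, norm_zero]
    exact zero_le_one
  · exact (norm_pow_le G k).trans (pow_le_one₀ (norm_nonneg _) hG)

/-- Propagation: if `G` essentially maps the complement of `Z (i + 1)` to the complement of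
`Z i`, and `Z 0` is everything, then `G ^ k` is negligible on the complement of `Z k`. -/
lemma norm_pow_mul_indicatorMatrix_le {G : Matrix n n ℂ} (hG : ‖G‖ ≤ 1) {Z : ℕ → Set n}
    (hZ : Z 0 = Set.univ) {η : ℝ} (hη : 0 ≤ η) (k : ℕ)
    (h : ∀ i < k, ∀ x ∈ Z i, ∀ y ∉ Z (i + 1), ‖G x y‖ ≤ η) :
    ‖G ^ k * indicatorMatrix (Z k)ᶜ‖ ≤ k * (Fintype.card n * η) := by
  induction k with
  | zero => simp [hZ, indicatorMatrix]
  | succ k ih =>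
    have ih' := ih fun i hi => h i (by omega)
    have hstep : ‖indicatorMatrix (Z k) * G * indicatorMatrix (Z (k + 1))ᶜ‖ ≤
        Fintype.card n * η := by
      refine l2_opNorm_le_of_entry_le _ hη fun x y => ?_
      rw [indicatorMatrix_mul_mul_apply]
      by_cases hx : x ∈ Z k
      · by_cases hy : y ∈ Z (k + 1)
        · simp [hy, hη]
        · simpa [hx, hy] using h k (Nat.lt_succ_self k) x hx y hy
      · simp [hx, hη]
    -- The partition `1 = 1_Z + 1_Zᶜ`, `Z = Z k`, is inserted before the last factor `G`: the
    -- complement is handled by induction, the rest by the entry bound.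
    have hsplit : G ^ (k + 1) * indicatorMatrix (Z (k + 1))ᶜ =
        G ^ k * indicatorMatrix (Z k)ᶜ * (G * indicatorMatrix (Z (k + 1))ᶜ) +
          G ^ k * (indicatorMatrix (Z k) * G * indicatorMatrix (Z (k + 1))ᶜ) := by
      calc G ^ (k + 1) * indicatorMatrix (Z (k + 1))ᶜ
          = G ^ k * (indicatorMatrix (Z k) + indicatorMatrix (Z k)ᶜ) * G *
              indicatorMatrix (Z (k + 1))ᶜ := by
            rw [indicatorMatrix_add_compl, mul_one, pow_succ]
        _ = _ := by noncomm_ring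
    rw [hsplit]
    refine (norm_add_le _ _).trans ?_
    have h1 : ‖G * indicatorMatrix (Z (k + 1))ᶜ‖ ≤ 1 :=
      (norm_mul_le _ _).trans (mul_le_one₀ hG (norm_nonneg _) (norm_indicatorMatrix_le_one _))
    have h2 := (norm_mul_le (G ^ k * indicatorMatrix (Z k)ᶜ)
      (G * indicatorMatrix (Z (k + 1))ᶜ)).trans
        (mul_le_of_le_one_right (norm_nonneg _) h1)
    have h3 := (norm_mul_le (G ^ k)
      (indicatorMatrix (Z k) * G * indicatorMatrix (Z (k + 1))ᶜ)).trans
        (mul_le_of_le_one_left (norm_nonneg _) (norm_pow_le_one_of_norm_le_one hG k))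
    push_cast
    linarith

/-- The adjoint of the preceding estimate. The indices in the hypothesis are swapped, which is what
the transposed baker matrix provides. -/
lemma norm_indicatorMatrix_mul_pow_le {G : Matrix n n ℂ} (hG : ‖G‖ ≤ 1) {Z : ℕ → Set n}
    (hZ : Z 0 = Set.univ) {η : ℝ} (hη : 0 ≤ η) (k : ℕ)
    (h : ∀ i < k, ∀ x ∈ Z i, ∀ y ∉ Z (i + 1), ‖G y x‖ ≤ η) :
    ‖indicatorMatrix (Z k)ᶜ * G ^ k‖ ≤ k * (Fintype.card n * η) := by
  have h1 := norm_pow_mul_indicatorMatrix_le (G := Gᴴ)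
    (by rwa [Matrix.l2_opNorm_conjTranspose]) hZ hη k fun i hi x hx y hy => by
      rw [Matrix.conjTranspose_apply, norm_star]
      exact h i hi x hx y hy
  rwa [← Matrix.l2_opNorm_conjTranspose, Matrix.conjTranspose_mul, Matrix.conjTranspose_pow,
    Matrix.conjTranspose_conjTranspose, indicatorMatrix_conjTranspose] at h1

/-- An eigenvalue estimate for a contraction whose powers are localized, both in position and in
frequency, to a set satisfying an uncertainty principle. -/
lemma norm_eigenvalue_pow_le {B F : Matrix n n ℂ} (hB : ‖B‖ ≤ 1) (hF : ‖F‖ ≤ 1) (hF' : Fᴴ * F = 1)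
    {S : Set n} {k : ℕ} {ε r : ℝ} (h1 : ‖B ^ k * indicatorMatrix Sᶜ‖ ≤ ε)
    (h2 : ‖indicatorMatrix Sᶜ * (F * B * Fᴴ) ^ k‖ ≤ ε)
    (h3 : ‖indicatorMatrix S * Fᴴ * indicatorMatrix S‖ ≤ r) {μ : ℂ} {u : n → ℂ} (hu : u ≠ 0)
    (hμ : B *ᵥ u = μ • u) : (‖μ‖ ^ k) ^ 2 ≤ 2 * ε + r * ‖μ‖ ^ k := by
  set Q : Matrix n n ℂ := indicatorMatrix S
  set P : Matrix n n ℂ := indicatorMatrix Sᶜ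
  have hQP : Q + P = 1 := indicatorMatrix_add_compl S
  have hFH : ‖Fᴴ‖ ≤ 1 := by rwa [Matrix.l2_opNorm_conjTranspose]
  have hBk := norm_pow_le_one_of_norm_le_one hB k
  have hQ : ‖Q‖ ≤ 1 := norm_indicatorMatrix_le_one S
  have hconj : ∀ j : ℕ, (F * B * Fᴴ) ^ j * F = F * B ^ j := by
    intro j
    induction j with
    | zero => simp
    | succ j ih =>
      rw [pow_succ, pow_succ', mul_assoc, mul_assoc (F * B), hF', mul_one, ← mul_assoc, ih,
        mul_assoc, ← pow_succ, pow_succ']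
  set X : Matrix n n ℂ := B ^ k * P * B ^ k + B ^ k * Q * Fᴴ * (P * (F * B * Fᴴ) ^ k) * F
  set Y : Matrix n n ℂ := B ^ k * (Q * Fᴴ * Q) * F
  -- The middle of `B ^ k * B ^ k` is localized to `S` first in position, then in frequency. Leaving
  -- a factor `B ^ k` to the right of `Y` preserves a power `μ ^ k`, so the main term bounds `|μ| ^
  -- k` by `r` and not merely `|μ| ^ (2 * k)`.
  have hXY : B ^ k * B ^ k = X + Y * B ^ k := by
    have e1 : B ^ k * Q * Fᴴ * (P * (F * B * Fᴴ) ^ k) * F = B ^ k * Q * Fᴴ * P * (F * B ^ k) := by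
      rw [← hconj]
      noncomm_ring
    have e2 : Y * B ^ k = B ^ k * Q * Fᴴ * Q * (F * B ^ k) := by
      simp only [Y]
      noncomm_ring
    have e3 : X + Y * B ^ k = B ^ k * P * B ^ k + B ^ k * Q * Fᴴ * (Q + P) * (F * B ^ k) := by
      simp only [X]
      rw [e1, e2]
      noncomm_ring
    rw [e3, hQP, mul_one, mul_assoc _ Fᴴ, ← mul_assoc Fᴴ, hF', one_mul, ← add_mul, ← mul_add,
      add_comm P, hQP, mul_one]
  have hX : ‖X‖ ≤ 2 * ε := by
    have a1 : ‖B ^ k * P * B ^ k‖ ≤ ε :=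
      ((norm_mul_le _ _).trans (mul_le_of_le_one_right (norm_nonneg _) hBk)).trans h1
    have a2 : ‖B ^ k * Q * Fᴴ‖ ≤ 1 :=
      (norm_mul_le _ _).trans (mul_le_one₀ ((norm_mul_le _ _).trans
        (mul_le_one₀ hBk (norm_nonneg _) hQ)) (norm_nonneg _) hFH)
    have a3 : ‖B ^ k * Q * Fᴴ * (P * (F * B * Fᴴ) ^ k) * F‖ ≤ ε :=
      ((norm_mul_le _ _).trans (mul_le_of_le_one_right (norm_nonneg _) hF)).trans
        (((norm_mul_le _ _).trans (mul_le_of_le_one_left (norm_nonneg _) a2)).trans h2)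
    have := norm_add_le (B ^ k * P * B ^ k) (B ^ k * Q * Fᴴ * (P * (F * B * Fᴴ) ^ k) * F)
    linarith
  have hY : ‖Y‖ ≤ r :=
    ((norm_mul_le _ _).trans (mul_le_of_le_one_right (norm_nonneg _) hF)).trans
      (((norm_mul_le _ _).trans (mul_le_of_le_one_left (norm_nonneg _) hBk)).trans h3)
  have hpow : ∀ j : ℕ, B ^ j *ᵥ u = μ ^ j • u := by
    intro j
    induction j with
    | zero => simp
    | succ j ih => rw [pow_succ, ← Matrix.mulVec_mulVec, hμ, Matrix.mulVec_smul, ih, smul_smul,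
        pow_succ']
  have hvec : (μ ^ k * μ ^ k) • u = X *ᵥ u + μ ^ k • (Y *ᵥ u) := by
    have := congrArg (· *ᵥ u) hXY
    simp only [Matrix.add_mulVec, ← Matrix.mulVec_mulVec, hpow, Matrix.mulVec_smul, smul_smul]
      at this
    exact this
  have hu' : 0 < ‖WithLp.toLp 2 u‖ := norm_pos_iff.2 (by simpa using hu)
  have hX' : ‖WithLp.toLp 2 (X *ᵥ u)‖ ≤ ‖X‖ * ‖WithLp.toLp 2 u‖ :=
    X.l2_opNorm_mulVec (WithLp.toLp 2 u)
  have hY' : ‖WithLp.toLp 2 (Y *ᵥ u)‖ ≤ ‖Y‖ * ‖WithLp.toLp 2 u‖ :=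
    Y.l2_opNorm_mulVec (WithLp.toLp 2 u)
  have hfin : ‖WithLp.toLp 2 ((μ ^ k * μ ^ k) • u)‖ ≤
      (2 * ε + r * ‖μ‖ ^ k) * ‖WithLp.toLp 2 u‖ := by
    rw [hvec, WithLp.toLp_add, WithLp.toLp_smul]
    refine (norm_add_le _ _).trans ?_
    rw [norm_smul, norm_pow]
    calc _ ≤ ‖X‖ * ‖WithLp.toLp 2 u‖ + ‖μ‖ ^ k * (‖Y‖ * ‖WithLp.toLp 2 u‖) := by gcongr
      _ ≤ 2 * ε * ‖WithLp.toLp 2 u‖ + ‖μ‖ ^ k * (r * ‖WithLp.toLp 2 u‖) := by gcongr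
      _ = _ := by ring
  rw [WithLp.toLp_smul, norm_smul, norm_mul, norm_pow, ← sq] at hfin
  exact le_of_mul_le_mul_right hfin hu'

end Indicator

/-! ### Application to the baker's map and Cantor neighbourhoods. -/

lemma FourierBound.norm_indicatorMatrix_le {N : ℕ} {K : ℝ} {S : Set (Fin N)} {Y : Finset ℕ}
    (hS : ∀ x : Fin N, x ∈ S ↔ (x : ℕ) ∈ Y) (hY : Y ⊆ Finset.range N) (hK : 0 ≤ K)
    (h : FourierBound Y N K) :
    ‖indicatorMatrix S * (fourierMatrix N)ᴴ * indicatorMatrix S‖ ≤ √(K / N) := by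
  refine l2_opNorm_le_of_sum_norm_sq_le _ (Real.sqrt_nonneg _) fun v => ?_
  rw [Real.sq_sqrt (by positivity)]
  let u : ℕ → ℂ := fun x => if hx : x < N then v ⟨x, hx⟩ else 0
  have hu : ∀ x : Fin N, u x = v x := fun x => by simp [u]
  have hcomp : ∀ y : Fin N,
      ((indicatorMatrix S * (fourierMatrix N)ᴴ * indicatorMatrix S) *ᵥ v) y =
      if (y : ℕ) ∈ Y then ((1 / √(N : ℝ) : ℝ) : ℂ) *
        ∑ x ∈ Y, u x * unitExp ((x : ℝ) * (y : ℕ) / N) else 0 := by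
    intro y
    rw [Matrix.mulVec, dotProduct]
    simp only [indicatorMatrix_mul_mul_apply]
    split_ifs with hy
    · have h3 : ∑ x ∈ Y, u x * unitExp ((x : ℝ) * (y : ℕ) / N) =
          ∑ x ∈ Finset.range N, if x ∈ Y then u x * unitExp ((x : ℝ) * (y : ℕ) / N) else 0 := by
        rw [Finset.sum_ite_mem, Finset.inter_eq_right.2 hY]
      rw [h3, ← Fin.sum_univ_eq_sum_range
        (fun x => if x ∈ Y then u x * unitExp ((x : ℝ) * (y : ℕ) / N) else 0), Finset.mul_sum]
      refine Finset.sum_congr rfl fun x _ => ?_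
      rw [fourierMatrix_conjTranspose_apply, mul_comm ((y : ℕ) : ℝ), hu,
        Set.indicator_of_mem ((hS y).2 hy)]
      split_ifs with hx
      · rw [Set.indicator_of_mem ((hS x).2 hx)]
        simp only [Pi.one_apply]
        ring
      · rw [Set.indicator_of_notMem (fun h => hx ((hS x).1 h))]
        ring
    · refine Finset.sum_eq_zero fun x _ => ?_
      rw [Set.indicator_of_notMem (fun h => hy ((hS y).1 h))]
      ring
  have hle : ∑ x ∈ Y, ‖u x‖ ^ 2 ≤ ∑ j, ‖v j‖ ^ 2 := by
    have : ∑ j, ‖v j‖ ^ 2 = ∑ x ∈ Finset.range N, ‖u x‖ ^ 2 := by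
      rw [← Fin.sum_univ_eq_sum_range (fun x => ‖u x‖ ^ 2)]
      simp only [hu]
    rw [this]
    exact Finset.sum_le_sum_of_subset_of_nonneg hY fun _ _ _ => by positivity
  have hlhs : ∑ y : Fin N,
      ‖((indicatorMatrix S * (fourierMatrix N)ᴴ * indicatorMatrix S) *ᵥ v) y‖ ^ 2 =
      (1 / N) * ∑ y ∈ Y, ‖∑ x ∈ Y, u x * unitExp ((x : ℝ) * y / N)‖ ^ 2 := by
    have h4 : ∀ y : Fin N,
        ‖((indicatorMatrix S * (fourierMatrix N)ᴴ * indicatorMatrix S) *ᵥ v) y‖ ^ 2 =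
        if (y : ℕ) ∈ Y then (1 / N) *
          ‖∑ x ∈ Y, u x * unitExp ((x : ℝ) * (y : ℕ) / N)‖ ^ 2 else 0 := by
      intro y
      rw [hcomp]
      split_ifs
      · rw [norm_mul, mul_pow, Complex.norm_real, Real.norm_eq_abs, sq_abs, div_pow, one_pow,
          Real.sq_sqrt (Nat.cast_nonneg _)]
      · simp
    simp only [h4]
    rw [Fin.sum_univ_eq_sum_range (fun y => if y ∈ Y then (1 / N : ℝ) *
      ‖∑ x ∈ Y, u x * unitExp ((x : ℝ) * y / N)‖ ^ 2 else 0), Finset.sum_ite_mem,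
      Finset.inter_eq_right.2 hY, Finset.mul_sum]
  rw [hlhs]
  calc _ ≤ (1 / N) * (K * ∑ x ∈ Y, ‖u x‖ ^ 2) := by gcongr; exact h u
    _ ≤ (1 / N) * (K * ∑ j, ‖v j‖ ^ 2) := by gcongr
    _ = _ := by ring

/-- The `W`-neighborhood of the `i`-th step of the construction of the Cantor set in
`{0, …, M ^ k - 1}`. -/
def cantorZone (M : ℕ) (A : Finset ℕ) (k W i : ℕ) : Set ℕ :=
  {l | ∃ p ∈ cantorFinset M A i, p * M ^ (k - i) ≤ l + W ∧ l ≤ (p + 1) * M ^ (k - i) + W}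

lemma mem_cantorZone_zero {M : ℕ} (A : Finset ℕ) {k l : ℕ} (W : ℕ) (hl : l < M ^ k) :
    l ∈ cantorZone M A k W 0 := by
  refine ⟨0, by simp [cantorFinset_zero], ?_, ?_⟩
  · simp
  · simp only [zero_add, one_mul, Nat.sub_zero]
    omega

/-- The expanding map sends points outside of a zone away from the previous zone. -/
lemma mem_cantorZone_succ {M : ℕ} (hM : 2 ≤ M) {A : Finset ℕ} (hA : A ⊆ Finset.range M)
    {k W i b j l : ℕ} (hi : i < k) (hb : b ∈ A) (hl : l ∈ cantorZone M A k W i)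
    (h1 : l ≤ M * j + W) (h2 : M * j ≤ l + W) :
    j + b * M ^ (k - 1) ∈ cantorZone M A k W (i + 1) := by
  obtain ⟨p, hp, hp1, hp2⟩ := hl
  obtain ⟨e, rfl⟩ := Nat.exists_eq_add_of_lt hi
  have e1 : i + e + 1 - i = e + 1 := by omega
  have e2 : i + e + 1 - (i + 1) = e := by omega
  have e3 : i + e + 1 - 1 = i + e := by omega
  rw [e1, pow_succ] at hp1 hp2
  -- One backward step of the expanding map prepends the digit `b` to the prefix `p`.
  have hmem : M ^ i * b + p ∈ cantorFinset M A (1 + i) :=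
    (mul_add_mem_cantorFinset (by omega) (mem_cantorFinset.1 hp).1).2
      ⟨by rwa [cantorFinset_one hA], hp⟩
  rw [add_comm] at hmem
  -- The width stays `W`: the kernel error raises it to `2 * W`, and division by `M ≥ 2` brings it
  -- back.
  have h3 : p * M ^ e ≤ j + W := by
    refine le_of_mul_le_mul_left (a := M) ?_ (Nat.zero_lt_of_lt hM)
    nlinarith
  have h4 : j ≤ (p + 1) * M ^ e + W := by
    refine le_of_mul_le_mul_left (a := M) ?_ (Nat.zero_lt_of_lt hM)
    nlinarith
  refine ⟨M ^ i * b + p, hmem, ?_, ?_⟩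
  · rw [e2, e3, pow_add]
    nlinarith
  · rw [e2, e3, pow_add]
    nlinarith

/-- All powers of an eigenvalue of the baker's map are controlled by the decay of its kernel away
from the graph of the expanding map and the uncertainty principle for the Cantor set. -/
lemma exists_eigenvalue_bound {M : ℕ} {A : Finset ℕ} (hM : 2 ≤ M) (hA : A ⊆ Finset.range M)
    {χ : ℝ → ℝ} (hχ : IsCutoff χ) (L : ℕ) :
    ∃ C : ℝ, 0 ≤ C ∧ ∀ (k W : ℕ) (K : ℝ), 0 < k → 0 < W → 0 ≤ K →
      FourierBound (cantorFinset M A k) (M ^ k) K →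
      ∀ μ ∈ spectrum ℂ (openBakerMap M A χ k),
        (‖μ‖ ^ k) ^ 2 ≤ 2 * (k * ((M : ℝ) ^ k * (C / (W : ℝ) ^ L))) +
          √(((2 * W + 2 : ℕ) : ℝ) ^ 2 * K / (M : ℝ) ^ k) * ‖μ‖ ^ k := by
  obtain ⟨C, hC0, hC⟩ := hχ.exists_bound_openBakerMatrix M L
  refine ⟨C, hC0, fun k W K hk hW hK hFB μ hμ => ?_⟩
  have hdiv : M ^ k / M = M ^ (k - 1) :=
    Nat.div_eq_of_eq_mul_left (by omega) (pow_sub_one_mul hk.ne' M).symm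
  have hN : M * (M ^ k / M) = M ^ k := by
    rw [hdiv, mul_comm, pow_sub_one_mul hk.ne']
  have hN0 : 0 < M ^ k := by positivity
  set B := openBakerMatrix M A χ (M ^ k) with hB
  let Z : ℕ → Set (Fin (M ^ k)) := fun i => {x | (x : ℕ) ∈ cantorZone M A k W i}
  have hZ0 : Z 0 = Set.univ := Set.eq_univ_of_forall fun x => mem_cantorZone_zero A W x.2
  have hη : 0 ≤ C / (W : ℝ) ^ L := by positivity
  have hentry : ∀ i < k, ∀ x ∈ Z i, ∀ y ∉ Z (i + 1), ‖B x y‖ ≤ C / (W : ℝ) ^ L := by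
    intro i hi x hx y hy
    obtain ⟨⟨c, j⟩, rfl⟩ := (blockEquiv hN).surjective y
    by_cases hc : (c : ℕ) ∈ A
    · refine hC _ hN A c x j W hN0 (by exact_mod_cast hW) ?_
      by_contra! hlt
      rw [abs_lt] at hlt
      refine hy ?_
      have h1 : (x : ℕ) ≤ M * (j : ℕ) + W := by
        have : ((x : ℕ) : ℝ) ≤ M * (j : ℕ) + W := by linarith
        exact_mod_cast this
      have h2 : M * (j : ℕ) ≤ (x : ℕ) + W := by
        have : (M : ℝ) * (j : ℕ) ≤ (x : ℕ) + W := by linarith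
        exact_mod_cast this
      have h3 := mem_cantorZone_succ hM hA hi hc hx h1 h2
      change (blockEquiv hN (c, j) : ℕ) ∈ cantorZone M A k W (i + 1)
      rw [blockEquiv_val]
      simpa only [hdiv] using h3
    · rw [hB, openBakerMatrix_apply_eq_zero hN χ hc, norm_zero]
      exact hη
  have hright := norm_pow_mul_indicatorMatrix_le (norm_openBakerMatrix_le_one hN A hχ) hZ0 hη k
    hentry
  have hleft := norm_indicatorMatrix_mul_pow_le (norm_openBakerMatrix_transpose_le_one hN A hχ) hZ0
    hη k hentry
  rw [openBakerMatrix_transpose] at hleft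
  rw [Fintype.card_fin, Nat.cast_pow] at hright hleft
  classical
  let Y : Finset ℕ := (Finset.range (M ^ k)).filter (· ∈ cantorZone M A k W k)
  -- In the last zone `y + W - p` ranges over `0, …, 2 * W + 1`, hence `2 * W + 2` shifts.
  have hY : FourierBound Y (M ^ k) (((2 * W + 2 : ℕ) : ℝ) ^ 2 * K) := by
    refine hFB.of_cover (R := W) fun y hy => ?_
    obtain ⟨p, hp, h1, h2⟩ := (Finset.mem_filter.1 hy).2
    rw [Nat.sub_self, pow_zero, mul_one] at h1 h2
    exact ⟨p, hp, y + W - p, by omega, by omega⟩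
  have hmid := hY.norm_indicatorMatrix_le (S := Z k)
    (fun x => by simp [Z]) (Finset.filter_subset _ _) (by positivity)
  rw [Nat.cast_pow] at hmid
  rw [openBakerMap, AlgEquiv.spectrum_eq, spectrum.mem_iff, Matrix.isUnit_iff_isUnit_det,
    isUnit_iff_ne_zero, not_not] at hμ
  obtain ⟨u, hu, hμu⟩ := Matrix.exists_mulVec_eq_zero_iff.2 hμ
  rw [Matrix.sub_mulVec, sub_eq_zero, Algebra.algebraMap_eq_smul_one, Matrix.smul_mulVec,
    Matrix.one_mulVec] at hμu
  exact norm_eigenvalue_pow_le (norm_openBakerMatrix_le_one hN A hχ) (norm_fourierMatrix_le_one _)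
    (fourierMatrix_conjTranspose_mul _) hright hleft hmid hu hμu.symm

end

/-! ### Choice of parameters and conclusion. -/

theorem theorem1 (M : ℕ) (A : Finset ℕ) (hAM : A ⊆ Finset.range M)
    (hA_gt : 1 < A.card) (hA_lt : A.card < M) :
    ∃ β : ℝ, max 0 (1 / 2 - Real.log (A.card : ℝ) / Real.log (M : ℝ)) < β ∧
      ∀ χ : ℝ → ℝ, IsCutoff χ →
        Filter.limsup (fun k : ℕ => spectralRadius ℂ (openBakerMap M A χ k)) Filter.atTop
          ≤ ENNReal.ofReal ((M : ℝ) ^ (-β)) := by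
  obtain ⟨β, hβm, hβ2, K, hK0, hK⟩ := exists_cantorFinset_uncertainty hAM hA_gt hA_lt
  -- The theorem is proved with `γ < β`; the difference `β - γ` pays for the width `W`, roughly `N ^
  -- (1 / t)` with `1 / t < β - γ`.
  obtain ⟨γ, hγm, hγβ⟩ := exists_between hβm
  refine ⟨γ, hγm, fun χ hχ => ?_⟩
  have hM : 2 ≤ M := by omega
  have hM1 : (1 : ℝ) < M := by exact_mod_cast (by omega : 1 < M)
  have hM0 : (0 : ℝ) < M := by linarith
  obtain ⟨s, hs⟩ := exists_nat_one_div_lt (sub_pos.2 hγβ)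
  set t := s + 1 with ht
  -- With `L = 3 * t` one has `W ^ L ≥ M ^ (3 * k)`. The propagation error is then at most a
  -- constant times `k * M ^ (-2 * k)`, negligible against `ν ^ (2 * k) ≥ M ^ (-k)`.
  obtain ⟨C, hC0, hC⟩ := exists_eigenvalue_bound hM hAM hχ (3 * t)
  set ν : ℝ := (M : ℝ) ^ (-γ) with hν
  have hν0 : 0 < ν := by positivity
  set ρ : ℝ := (M : ℝ) ^ (1 / ((s : ℝ) + 1) - (β - γ)) with hρ
  have hρ0 : 0 < ρ := by positivity
  have hρ1 : ρ < 1 := Real.rpow_lt_one_of_one_lt_of_neg hM1 (by linarith)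
  have hlim : Filter.Tendsto (fun k : ℕ => 2 * C * (k * (1 / (M : ℝ)) ^ k) + 4 * M * √K * ρ ^ k)
      Filter.atTop (nhds (2 * C * 0 + 4 * M * √K * 0)) := by
    refine Filter.Tendsto.add (Filter.Tendsto.const_mul _ ?_) (Filter.Tendsto.const_mul _ ?_)
    · exact tendsto_self_mul_const_pow_of_lt_one (by positivity) ((div_lt_one hM0).2 hM1)
    · exact tendsto_pow_atTop_nhds_zero_of_lt_one hρ0.le hρ1
  rw [mul_zero, mul_zero, add_zero] at hlim
  refine Filter.limsup_le_of_le (by isBoundedDefault) ?_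
  filter_upwards [hlim.eventually (gt_mem_nhds zero_lt_one), Filter.eventually_gt_atTop 0]
    with k hk hk0
  refine iSup₂_le fun μ hμ => ?_
  rw [← ENNReal.ofReal_coe_nnreal, coe_nnnorm]
  refine ENNReal.ofReal_le_ofReal ?_
  by_contra! hlt
  have hb := hC k (M ^ (k / t + 1)) _ hk0 (by positivity) (by positivity) (hK k) μ hμ
  have hW : ((M ^ (k / t + 1) : ℕ) : ℝ) = (M : ℝ) ^ (k / t + 1) := by push_cast; rfl
  rw [hW] at hb
  have hx : ν ^ k ≤ ‖μ‖ ^ k := by gcongr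
  set x := ‖μ‖ ^ k
  set σ : ℝ := (M : ℝ) ^ (-β) with hσ
  set τ : ℝ := (M : ℝ) ^ (1 / ((s : ℝ) + 1)) with hτ
  have hσ0 : 0 < σ := by positivity
  have hτ0 : 0 < τ := by positivity
  have hν2 : 1 / (M : ℝ) ≤ ν ^ 2 := by
    rw [hν, ← Real.rpow_natCast, ← Real.rpow_mul hM0.le, one_div, ← Real.rpow_neg_one]
    refine Real.rpow_le_rpow_of_exponent_le hM1.le ?_
    push_cast
    linarith
  -- The width loss `τ` times the uncertainty gain `σ` beats the target rate `ν` by the factor `ρ <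
  -- 1`.
  have hρν : ρ * ν = τ * σ := by
    rw [hρ, hν, hτ, hσ, ← Real.rpow_add hM0, ← Real.rpow_add hM0]
    congr 1
    ring
  have hτk : (M : ℝ) ^ (k / t) ≤ τ ^ k := by
    rw [hτ, ← Real.rpow_natCast, ← Real.rpow_natCast, ← Real.rpow_mul hM0.le]
    refine Real.rpow_le_rpow_of_exponent_le hM1.le ?_
    have := Nat.cast_div_le (α := ℝ) (m := k) (n := t)
    rw [ht] at this ⊢
    push_cast at this
    calc _ ≤ (k : ℝ) / (s + 1) := this
      _ = _ := by ring
  have hσ2 : (M : ℝ) ^ (1 - 2 * β) = σ ^ 2 * M := by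
    rw [hσ, ← Real.rpow_natCast, ← Real.rpow_mul hM0.le, ← Real.rpow_add_one hM0.ne']
    congr 1
    push_cast
    ring
  have herr : 2 * (k * ((M : ℝ) ^ k * (C / ((M : ℝ) ^ (k / t + 1)) ^ (3 * t)))) ≤
      2 * C * (k * (1 / (M : ℝ)) ^ k) * (ν ^ k) ^ 2 := by
    have h1 : (M : ℝ) ^ (3 * k) ≤ ((M : ℝ) ^ (k / t + 1)) ^ (3 * t) := by
      rw [← pow_mul]
      refine pow_le_pow_right₀ hM1.le ?_
      have := Nat.lt_div_mul_add (a := k) (b := t) (by omega)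
      calc 3 * k ≤ 3 * (k / t * t + t) := Nat.mul_le_mul_left _ this.le
        _ = (k / t + 1) * (3 * t) := by ring
    have h2 : (1 / (M : ℝ)) ^ k ≤ (ν ^ k) ^ 2 := by
      rw [← pow_mul, mul_comm k, pow_mul]
      gcongr
    calc _ ≤ 2 * (k * ((M : ℝ) ^ k * (C / (M : ℝ) ^ (3 * k)))) := by gcongr
      _ = 2 * C * (k * (1 / (M : ℝ)) ^ k) * (1 / (M : ℝ)) ^ k := by
        rw [div_pow, one_pow, mul_comm 3 k, pow_mul]
        field_simp
      _ ≤ _ := by gcongr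
  have hmain : √(((2 * M ^ (k / t + 1) + 2 : ℕ) : ℝ) ^ 2 *
      (K * ((M : ℝ) ^ (1 - 2 * β)) ^ k) / (M : ℝ) ^ k) ≤ 4 * M * √K * ρ ^ k * ν ^ k := by
    have h1 : ((2 * M ^ (k / t + 1) + 2 : ℕ) : ℝ) ≤ 4 * M * τ ^ k := by
      have h2 : 1 ≤ (M : ℝ) ^ (k / t + 1) := one_le_pow₀ hM1.le
      push_cast
      calc 2 * (M : ℝ) ^ (k / t + 1) + 2 ≤ 4 * (M : ℝ) ^ (k / t + 1) := by linarith
        _ = 4 * M * M ^ (k / t) := by ring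
        _ ≤ _ := by gcongr
    have h3 : ((2 * M ^ (k / t + 1) + 2 : ℕ) : ℝ) ^ 2 *
        (K * ((M : ℝ) ^ (1 - 2 * β)) ^ k) / (M : ℝ) ^ k =
        ((2 * M ^ (k / t + 1) + 2 : ℕ) * σ ^ k) ^ 2 * K := by
      rw [hσ2, mul_pow (σ ^ 2)]
      field_simp
      ring
    rw [h3, Real.sqrt_mul (by positivity), Real.sqrt_sq (by positivity)]
    calc _ ≤ 4 * M * τ ^ k * σ ^ k * √K := by gcongr
      _ = 4 * M * √K * (τ * σ) ^ k := by ring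
      _ = _ := by
        rw [← hρν]
        ring
  have hνk : 0 < ν ^ k := by positivity
  have hx0 : 0 < x := hνk.trans_le hx
  -- Since `ν ^ k ≤ x`, both terms are bounded by multiples of `x ^ 2` whose total coefficient is
  -- below `1` for large `k`, a contradiction.
  have hfin : x ^ 2 ≤ (2 * C * (k * (1 / (M : ℝ)) ^ k) + 4 * M * √K * ρ ^ k) * x ^ 2 := by
    calc x ^ 2 ≤ 2 * C * (k * (1 / (M : ℝ)) ^ k) * (ν ^ k) ^ 2 +
          4 * M * √K * ρ ^ k * ν ^ k * x := hb.trans (by gcongr)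
      _ ≤ 2 * C * (k * (1 / (M : ℝ)) ^ k) * x ^ 2 + 4 * M * √K * ρ ^ k * x * x := by gcongr
      _ = _ := by ring
  have hx2 : 0 < x ^ 2 := by positivity
  exact lt_irrefl _ (hfin.trans_lt (mul_lt_of_lt_one_left hx2 hk))
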